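/- Let $\alpha>-1$, let $dA_\alpha(z)=\frac{\alpha+1}{\pi}(1-|z|^2)^\alpha\,dx\,dy$ on the unit disk $\mathbb D$, and let $\mathbb P_\alpha$ be the orthogonal projection of $L^2(\mathbb D,dA_\alpha)$ (complex-valued functions) onto its closed subspace of square-integrable harmonic functions on $\mathbb D$. Let $R>1$, let $\mathbb D(R)=\{z\in\mathbb C:|z|<R\}$, and let $u:\mathbb D(R)\to[-\infty,\infty)$ be subharmonic on $\mathbb D(R)$ and (finite and) harmonic on $\mathbb D(R)\setminus\{0\}$. Let $M_u$ be the operator $f\mapsto uf$ on $L^2(\mathbb D,dA_\alpha)$ with domain $\{f: uf\in L^2(\mathbb D,dA_\alpha)\}$, and let $\mathscr C_u=M_u\mathbb P_\alpha-\mathbb P_\alpha M_u$ with domain $\{f\in\operatorname{dom}M_u:\mathbb P_\alpha f\in\operatorname{dom}M_u\}$. Then: 1. $M_u$ and $\mathbb P_\alpha$ commute, i.e. for every $f\in\operatorname{dom}M_u$ one has $\mathbb P_\alpha f\in\operatorname{dom}M_u$ and $M_u\mathbb P_\alpha f=\mathbb P_\alpha M_uf$, if and only if $u$ is constant on $\mathbb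 D(R)$. 2. For every real $p>1$, $\mathscr C_u$ belongs to the von Neumann–Schatten class $\mathcal C_p$: it is densely defined, and it extends to a compact operator on $L^2(\mathbb D,dA_\alpha)$ whose singular values $s_n$ (the eigenvalues of $|\mathscr C_u|=(\mathscr C_u^*\mathscr C_u)^{1/2}$ in non-increasing order, with multiplicity) satisfy $\sum_n s_n^p<\infty$. -/

import Mathlib

namespace HarmonicCommutator

open MeasureTheory InnerProductSpace Metric Filter Topology
open scoped ENNReal

noncomputable section

/-- The measure `dA_α = ((α + 1) / π) (1 - |z|²) ^ α dx dy` on the unit disk, seen as a measure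
on `ℂ` that does not charge the complement of the disk. -/
def dA (α : ℝ) : Measure ℂ :=
  (volume.restrict (ball (0 : ℂ) 1)).withDensity
    (fun z => ENNReal.ofReal ((α + 1) / Real.pi * (1 - ‖z‖ ^ 2) ^ α))

/-- The Hilbert space `L²(𝔻, dA_α)` of complex-valued functions. -/
abbrev L2 (α : ℝ) : Type := Lp ℂ 2 (dA α)

/-- `ℋ²_α(𝔻)`: the (classes of) complex-valued harmonic functions on the unit disk that are
square-integrable with respect to `dA_α`. -/
def harmonicSubspace (α : ℝ) : Submodule ℂ (L2 α) where
  carrier := {f | ∃ h : ℂ → ℂ, HarmonicOnNhd h (ball 0 1) ∧ f =ᵐ[dA α] h}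
  add_mem' := by
    rintro f g ⟨h, hh, hf⟩ ⟨k, hk, hg⟩
    exact ⟨h + k, hh.add hk, (Lp.coeFn_add f g).trans (hf.add hg)⟩
  zero_mem' := ⟨fun _ => 0, harmonicOnNhd_const 0, Lp.coeFn_zero _ _ _⟩
  smul_mem' := by
    rintro c f ⟨h, hh, hf⟩
    refine ⟨c • h, ?_, (Lp.coeFn_smul c f).trans (hf.const_smul c)⟩
    exact hh.comp_CLM (c • ContinuousLinearMap.id ℝ ℂ)


/-- Uniform limits of real harmonic functions are harmonic. -/
theorem harmonicOnNhd_real_of_tendstoUniformlyOn {h : ℂ → ℝ} {H : ℕ → ℂ → ℝ} {r : ℝ} (hr : 0 < r)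
    (hH : ∀ n, HarmonicOnNhd (H n) (closedBall 0 r))
    (hlim : TendstoUniformlyOn H h atTop (closedBall 0 r)) : HarmonicOnNhd h (ball 0 r) := by
  lift r to NNReal using hr.le
  have hc : ContinuousOn h (closedBall 0 r) :=
    hlim.continuousOn (Frequently.of_forall fun n => (hH n).continuousOn)
  have hcs : ContinuousOn (fun z => (h z : ℂ)) (sphere 0 r) :=
    Complex.continuous_ofReal.comp_continuousOn (hc.mono sphere_subset_closedBall)
  have hci : CircleIntegrable (fun z => (h z : ℂ)) 0 r := hcs.circleIntegrable hr.le
  set G : ℂ → ℂ := fun w => 2 * ((2 * Real.pi * Complex.I)⁻¹ • ∮ z in C(0, r), (z - w)⁻¹ • (h z : ℂ))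
    - Real.circleAverage (fun z => (h z : ℂ)) 0 r with hG
  have hGan : ∀ w ∈ ball (0 : ℂ) r, AnalyticAt ℂ G w := by
    intro w hw
    have := (hasFPowerSeriesOn_cauchy_integral (f := fun z => (h z : ℂ)) hci hr)
    have := this.analyticAt_of_mem (y := w) (by rw [eball_coe]; exact hw)
    exact (analyticAt_const.mul this).sub analyticAt_const
  have key : ∀ w ∈ ball (0 : ℂ) r, h w = (G w).re := by
    intro w hw
    have hne : ∀ z ∈ sphere (0 : ℂ) r, z - w ≠ 0 := by
      intro z hz h0
      rw [sub_eq_zero] at h0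
      subst h0
      simp at hz hw
      linarith
    have hkc : ContinuousOn (herglotzRieszKernel 0 w) (sphere 0 r) := by
      rw [herglotzRieszKernel_fun_def]
      simp only [sub_zero]
      exact ContinuousOn.div (by fun_prop) (by fun_prop) hne
    have hki : CircleIntegrable (fun z => herglotzRieszKernel 0 w z * (h z : ℂ)) 0 r :=
      (hkc.mul hcs).circleIntegrable hr.le
    have e1 : Real.circleAverage (fun z => herglotzRieszKernel 0 w z * (h z : ℂ)) 0 r = G w := by
      have hc2 : ContinuousOn (fun z => (z - w)⁻¹ * z * (h z : ℂ)) (sphere 0 r) :=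
        ((ContinuousOn.inv₀ (by fun_prop) hne).mul (by fun_prop)).mul hcs
      have : Set.EqOn (fun z => herglotzRieszKernel 0 w z * (h z : ℂ))
          (fun z => (2 : ℂ) • ((z - w)⁻¹ * z * (h z : ℂ)) - (h z : ℂ)) (sphere 0 |(r : ℝ)|) := by
        intro z hz
        rw [abs_of_pos hr] at hz
        have := hne z hz
        simp only [herglotzRieszKernel_def, sub_zero, smul_eq_mul]
        field_simp
        ring
      rw [Real.circleAverage_congr_sphere this, Real.circleAverage_fun_sub
        (f₁ := fun z => (2 : ℂ) • ((z - w)⁻¹ * z * (h z : ℂ)))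
        ((hc2.const_smul (2 : ℂ)).circleIntegrable hr.le) hci, Real.circleAverage_fun_smul, hG]
      simp only
      rw [Real.circleAverage_eq_circleIntegral hr.ne', smul_eq_mul]
      congr 3
      refine circleIntegral.integral_congr hr.le ?_
      intro z hz
      have hz0 : z ≠ 0 := by
        rintro rfl
        simp at hz
        exact hr.ne hz
      simp only [smul_eq_mul, sub_zero]
      field_simp
    have e2 : (G w).re = Real.circleAverage ((Complex.re ∘ herglotzRieszKernel 0 w) • h) 0 r := by
      rw [← e1]
      have := Complex.reCLM.circleAverage_comp_comm hki
      simp only [Complex.reCLM_apply] at this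
      rw [← this]
      congr 1
      ext z
      simp
    rw [e2]
    refine tendsto_nhds_unique (hlim.tendsto_at (ball_subset_closedBall hw)) ?_
    have e3 : ∀ n, H n w = Real.circleAverage ((Complex.re ∘ herglotzRieszKernel 0 w) • H n) 0 r :=
      fun n => ((hH n).circleAverage_re_herglotzRieszKernel_smul hw).symm
    simp_rw [e3]
    have hkr : ContinuousOn (Complex.re ∘ herglotzRieszKernel 0 w) (sphere 0 r) :=
      Complex.continuous_re.comp_continuousOn hkc
    obtain ⟨K, hK⟩ := (isCompact_sphere (0 : ℂ) r).exists_bound_of_continuousOn hkr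
    have hKp : 0 < |K| + 1 := by positivity
    rw [Metric.tendsto_atTop]
    intro ε hε
    obtain ⟨N, hN⟩ := eventually_atTop.1
      (Metric.tendstoUniformlyOn_iff.1 hlim (ε / 2 / (|K| + 1)) (by positivity))
    refine ⟨N, fun n hn => ?_⟩
    have c1 := hkr.smul ((hH n).continuousOn.mono sphere_subset_closedBall)
    have c2 := hkr.smul (hc.mono sphere_subset_closedBall)
    rw [Real.dist_eq, ← Real.circleAverage_sub (c1.circleIntegrable hr.le)
      (c2.circleIntegrable hr.le)]
    refine lt_of_le_of_lt (Real.abs_circleAverage_le_circleAverage_abs) (lt_of_le_of_lt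
      (Real.circleAverage_mono_on_of_le_circle (a := ε / 2)
        (((c1.sub c2).abs).circleIntegrable hr.le) ?_) (half_lt_self hε))
    intro z hz
    rw [abs_of_pos hr] at hz
    have h1 := hN n hn z (sphere_subset_closedBall hz)
    have h2 := hK z hz
    simp only [Pi.abs_apply, Pi.sub_apply, smul_eq_mul, Pi.mul_apply]
    rw [← mul_sub, abs_mul]
    rw [dist_comm, Real.dist_eq] at h1
    rw [Real.norm_eq_abs] at h2
    calc _ ≤ (|K| + 1) * (ε / 2 / (|K| + 1)) := by
          gcongr
          linarith [le_abs_self K]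
      _ = ε / 2 := by field_simp
  intro w hw
  refine (harmonicAt_congr_nhds ?_).2 (hGan w hw).harmonicAt_re
  filter_upwards [isOpen_ball.mem_nhds hw] with z hz using key z hz

/-- Uniform limits of complex harmonic functions are harmonic. -/
theorem harmonicOnNhd_of_tendstoUniformlyOn {h : ℂ → ℂ} {H : ℕ → ℂ → ℂ} {r : ℝ} (hr : 0 < r)
    (hH : ∀ n, HarmonicOnNhd (H n) (closedBall 0 r))
    (hlim : TendstoUniformlyOn H h atTop (closedBall 0 r)) : HarmonicOnNhd h (ball 0 r) := by
  have h1 := harmonicOnNhd_real_of_tendstoUniformlyOn (H := fun n => Complex.reCLM ∘ H n) hr (fun n => (hH n).comp_CLM _)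
    (Complex.reCLM.uniformContinuous.comp_tendstoUniformlyOn hlim)
  have h2 := harmonicOnNhd_real_of_tendstoUniformlyOn (H := fun n => Complex.imCLM ∘ H n) hr (fun n => (hH n).comp_CLM _)
    (Complex.imCLM.uniformContinuous.comp_tendstoUniformlyOn hlim)
  have h3 := (h1.comp_CLM Complex.ofRealCLM).add
    (h2.comp_CLM ((ContinuousLinearMap.mul ℝ ℂ Complex.I).comp Complex.ofRealCLM))
  convert h3 using 1
  ext z
  simp [mul_comm Complex.I, Complex.re_add_im]

/-- Area form of the mean value inequality. -/
theorem enorm_le_lintegral_ball {g : ℂ → ℂ} {z : ℂ} {ρ : ℝ} (hρ : 0 < ρ)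
    (hg : HarmonicOnNhd g (closedBall z ρ)) (hm : Measurable g) :
    ENNReal.ofReal (ρ / 2) * (ENNReal.ofReal (ρ / 2) * (ENNReal.ofReal (2 * Real.pi) * ‖g z‖ₑ)) ≤
      ∫⁻ w in ball z ρ, ‖g w‖ₑ := by
  have hmF : Measurable ((ball z ρ).indicator fun w => ‖g w‖ₑ) :=
    hm.enorm.indicator measurableSet_ball
  have hps : Measurable fun p : ℝ × ℝ => Complex.polarCoord.symm p + z := by
    simp_rw [Complex.polarCoord_symm_apply]
    fun_prop
  rw [← lintegral_indicator measurableSet_ball, ← lintegral_add_right_eq_self _ z,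
    ← Complex.lintegral_comp_polarCoord_symm, polarCoord_target, Measure.volume_eq_prod,
    ← Measure.prod_restrict, lintegral_prod]
  · calc ENNReal.ofReal (ρ / 2) * (ENNReal.ofReal (ρ / 2) * (ENNReal.ofReal (2 * Real.pi) * ‖g z‖ₑ))
      = ∫⁻ t in Set.Ioo (ρ / 2) ρ, ENNReal.ofReal (ρ / 2) * (ENNReal.ofReal (2 * Real.pi) * ‖g z‖ₑ) := by
          rw [setLIntegral_const, Real.volume_Ioo, mul_comm]
          congr 2
          ring
      _ ≤ ∫⁻ t in Set.Ioo (ρ / 2) ρ, ∫⁻ θ in Set.Ioo (-Real.pi) Real.pi, ENNReal.ofReal t •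
          (ball z ρ).indicator (fun w => ‖g w‖ₑ) (Complex.polarCoord.symm (t, θ) + z) := by
        refine setLIntegral_mono' measurableSet_Ioo ?_
        rintro t ⟨ht1, ht2⟩
        have ht0 : 0 < t := by linarith
        simp_rw [smul_eq_mul]
        rw [lintegral_const_mul]
        · gcongr
          have hmem : ∀ θ : ℝ, Complex.polarCoord.symm (t, θ) + z = circleMap z t θ := by
            intro θ
            rw [Complex.polarCoord_symm_apply, circleMap, add_comm, Complex.exp_mul_I]
            simp
          have hb : ∀ θ : ℝ, circleMap z t θ ∈ ball z ρ := by
            intro θ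
            simp [mem_ball, dist_eq_norm, abs_of_pos ht0, ht2]
          simp_rw [hmem, Set.indicator_of_mem (hb _)]
          have hmv : Real.circleAverage g z t = g z :=
            InnerProductSpace.HarmonicOnNhd.circleAverage_eq (hg.mono (by
              rw [abs_of_pos ht0]; exact closedBall_subset_closedBall ht2.le))
          rw [Real.circleAverage_eq_integral_add (-Real.pi),
            intervalIntegral.integral_comp_add_right (fun θ => g (circleMap z t θ))] at hmv
          rw [show (0 : ℝ) + -Real.pi = -Real.pi by ring,
            show 2 * Real.pi + -Real.pi = Real.pi by ring] at hmv
          have h2 : (2 * Real.pi) • g z = ∫ θ in (-Real.pi)..Real.pi, g (circleMap z t θ) := by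
            rw [← hmv, smul_smul, mul_inv_cancel₀ (by positivity), one_smul]
          rw [intervalIntegral.integral_of_le (by linarith [Real.pi_pos]),
            integral_Ioc_eq_integral_Ioo] at h2
          calc ENNReal.ofReal (2 * Real.pi) * ‖g z‖ₑ = ‖(2 * Real.pi) • g z‖ₑ := by
                rw [enorm_smul, Real.enorm_eq_ofReal (by positivity)]
            _ ≤ _ := by
                rw [h2]
                exact enorm_integral_le_lintegral_enorm _
        · exact hmF.comp (hps.comp measurable_prodMk_left)
      _ ≤ _ := lintegral_mono_set (fun t ht => by
        have := ht.1
        simp only [Set.mem_Ioi]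
        linarith)
  · refine Measurable.aemeasurable ?_
    exact (by fun_prop : Measurable fun p : ℝ × ℝ => ENNReal.ofReal p.1).smul
      (hmF.comp hps)


/-- Point evaluations are locally uniformly bounded on `ℋ²_α(𝔻)`. -/
theorem norm_le_of_mem_harmonicSubspace (α : ℝ) (hα : -1 < α) {r : ℝ} (hr : 0 < r) (hr1 : r < 1) :
    ∃ C : ℝ, 0 ≤ C ∧ ∀ (f : L2 α) (g : ℂ → ℂ), HarmonicOnNhd g (ball 0 1) → Measurable g →
      f =ᵐ[dA α] g → ∀ z ∈ closedBall (0 : ℂ) r, ‖g z‖ ≤ C * ‖f‖ := by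
  set r' : ℝ := (1 + r) / 2 with hr'
  set ρ : ℝ := (1 - r) / 2 with hρ'
  have hρ : 0 < ρ := by linarith
  set δ : ℂ → ℝ := fun z => (α + 1) / Real.pi * (1 - ‖z‖ ^ 2) ^ α with hδ
  have hpos : ∀ z ∈ closedBall (0 : ℂ) r', 0 < 1 - ‖z‖ ^ 2 := by
    intro z hz
    have h1 : ‖z‖ ≤ r' := by simpa using hz
    nlinarith [norm_nonneg z]
  obtain ⟨z₀, hz₀, hmin⟩ := (isCompact_closedBall (0 : ℂ) r').exists_isMinOn
    ⟨0, by simp; linarith⟩ (f := δ) (by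
      refine ContinuousOn.mul continuousOn_const (ContinuousOn.rpow_const (by fun_prop) ?_)
      exact fun z hz => Or.inl (hpos z hz).ne')
  have hm : 0 < δ z₀ := mul_pos (div_pos (by linarith) Real.pi_pos)
    (Real.rpow_pos_of_pos (hpos z₀ hz₀) _)
  have hle : volume.restrict (ball (0 : ℂ) r') ≤ ENNReal.ofReal (δ z₀)⁻¹ • dA α := by
    refine Measure.le_iff.2 fun s hs => ?_
    rw [Measure.restrict_apply hs, Measure.smul_apply, smul_eq_mul]
    have hsb : MeasurableSet (s ∩ ball (0 : ℂ) r') := hs.inter measurableSet_ball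
    have hss : s ∩ ball (0 : ℂ) r' ⊆ ball 0 1 :=
      Set.inter_subset_right.trans (ball_subset_ball (by linarith))
    calc volume (s ∩ ball (0 : ℂ) r')
        = ENNReal.ofReal (δ z₀)⁻¹ * (ENNReal.ofReal (δ z₀) * volume (s ∩ ball (0 : ℂ) r')) := by
          rw [← mul_assoc, ← ENNReal.ofReal_mul (by positivity), inv_mul_cancel₀ hm.ne',
            ENNReal.ofReal_one, one_mul]
      _ ≤ ENNReal.ofReal (δ z₀)⁻¹ * dA α (s ∩ ball (0 : ℂ) r') := by
          gcongr
          rw [dA, withDensity_apply _ hsb, Measure.restrict_restrict hsb,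
            Set.inter_eq_left.2 hss, ← setLIntegral_const]
          refine setLIntegral_mono' hsb fun z hz => ?_
          exact ENNReal.ofReal_le_ofReal (hmin (ball_subset_closedBall hz.2))
      _ ≤ _ := by
          gcongr
          exact Set.inter_subset_left
  set A : ℝ≥0∞ := ENNReal.ofReal (ρ / 2) * ENNReal.ofReal (ρ / 2) * ENNReal.ofReal (2 * Real.pi)
    with hA
  have hA0 : A ≠ 0 := by
    simp [hA, hρ, Real.pi_pos]
  have hAt : A ≠ ⊤ := by
    simp [hA, ENNReal.mul_eq_top]
  set V : ℝ≥0∞ := volume.restrict (ball (0 : ℂ) r') Set.univ ^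
    (1 / (1 : ℝ≥0∞).toReal - 1 / (2 : ℝ≥0∞).toReal) with hV
  have hVt : V ≠ ⊤ := by
    refine ENNReal.rpow_ne_top_of_nonneg (by norm_num) ?_
    rw [Measure.restrict_apply_univ]
    exact measure_ball_lt_top.ne
  set B : ℝ≥0∞ := ENNReal.ofReal (δ z₀)⁻¹ ^ (1 / (2 : ℝ≥0∞)).toReal with hB
  have hBt : B ≠ ⊤ := ENNReal.rpow_ne_top_of_nonneg ENNReal.toReal_nonneg ENNReal.ofReal_ne_top
  refine ⟨(A⁻¹ * (B * V)).toReal, ENNReal.toReal_nonneg, fun f g hg hgm hfg z hz => ?_⟩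
  have hzr : ‖z‖ ≤ r := by simpa using hz
  have h1 := enorm_le_lintegral_ball hρ (z := z) (hg.mono (fun w hw => by
    rw [mem_closedBall, dist_eq_norm] at hw
    rw [mem_ball_zero_iff]
    have := norm_le_norm_add_norm_sub' w z
    linarith)) hgm
  have h2 : ∫⁻ w in ball z ρ, ‖g w‖ₑ ≤ ∫⁻ w in ball 0 r', ‖g w‖ₑ := by
    refine lintegral_mono_set fun w hw => ?_
    rw [mem_ball, dist_eq_norm] at hw
    rw [mem_ball_zero_iff]
    have := norm_le_norm_add_norm_sub' w z
    linarith
  have h3 := eLpNorm_le_eLpNorm_mul_rpow_measure_univ (p := 1) (q := 2) (f := g) (by norm_num)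
    (hgm.aestronglyMeasurable (μ := volume.restrict (ball (0 : ℂ) r')))
  rw [eLpNorm_one_eq_lintegral_enorm] at h3
  have h4 := eLpNorm_le_of_measure_le_smul hle (f := g) (p := 2)
  rw [← eLpNorm_congr_ae hfg, smul_eq_mul] at h4
  have h5 : A * ‖g z‖ₑ ≤ B * V * eLpNorm f 2 (dA α) := by
    calc A * ‖g z‖ₑ ≤ _ := by
          rw [hA, mul_assoc, mul_assoc]
          exact h1
      _ ≤ _ := h2
      _ ≤ _ := h3
      _ ≤ B * eLpNorm f 2 (dA α) * V := by gcongr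
      _ = _ := by ring
  have h6 : ‖g z‖ₑ ≤ A⁻¹ * (B * V) * eLpNorm f 2 (dA α) := by
    calc ‖g z‖ₑ = A⁻¹ * (A * ‖g z‖ₑ) := by
          rw [← mul_assoc, ENNReal.inv_mul_cancel hA0 hAt, one_mul]
      _ ≤ A⁻¹ * (B * V * eLpNorm f 2 (dA α)) := by gcongr
      _ = _ := by ring
  rw [Lp.norm_def, ← ENNReal.toReal_mul, ← toReal_enorm]
  refine ENNReal.toReal_mono ?_ h6
  exact ENNReal.mul_ne_top (ENNReal.mul_ne_top (ENNReal.inv_ne_top.2 hA0)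
    (ENNReal.mul_ne_top hBt hVt)) (Lp.eLpNorm_ne_top f)

/-- `ℋ²_α(𝔻)` is closed, so that the orthogonal projection onto it exists. -/
theorem isClosed_harmonicSubspace (α : ℝ) : IsClosed (harmonicSubspace α : Set (L2 α)) := by
  have hac : dA α ≪ volume.restrict (ball (0 : ℂ) 1) := withDensity_absolutelyContinuous _ _
  rcases le_or_gt α (-1) with hα | hα
  · have h0 : dA α ≪ 0 := by
      rw [Measure.absolutelyContinuous_zero_iff, dA, withDensity_eq_zero_iff]
      · refine (ae_restrict_iff' measurableSet_ball).2 (Eventually.of_forall fun z hz => ?_)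
        have h1 : ‖z‖ < 1 := by simpa using hz
        refine ENNReal.ofReal_of_nonpos (mul_nonpos_of_nonpos_of_nonneg ?_
          (Real.rpow_nonneg (by nlinarith [norm_nonneg z]) _))
        exact div_nonpos_of_nonpos_of_nonneg (by linarith) Real.pi_pos.le
      · exact (by fun_prop : Measurable _).aemeasurable
    have : (harmonicSubspace α : Set (L2 α)) = Set.univ := Set.eq_univ_of_forall fun f =>
      ⟨fun _ => 0, harmonicOnNhd_const 0, h0.ae_le (by simp)⟩
    rw [this]
    exact isClosed_univ
  refine IsSeqClosed.isClosed fun f f₀ hf hlim => ?_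
  choose k hk hfk using hf
  set g : ℕ → ℂ → ℂ := fun n => (ball (0 : ℂ) 1).indicator (k n) with hg
  have hgk : ∀ n, Set.EqOn (g n) (k n) (ball 0 1) := fun n z hz => Set.indicator_of_mem hz _
  have hgh : ∀ n, HarmonicOnNhd (g n) (ball 0 1) := fun n z hz =>
    (harmonicAt_congr_nhds ((hgk n).eventuallyEq_of_mem (isOpen_ball.mem_nhds hz))).2 (hk n z hz)
  have hgm : ∀ n, Measurable (g n) := fun n => by
    classical
    simp only [hg]
    rw [← Set.piecewise_eq_indicator]
    exact (hk n).continuousOn.measurable_piecewise continuousOn_const measurableSet_ball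
  have hball : ∀ᵐ z ∂(dA α), z ∈ ball (0 : ℂ) 1 :=
    hac.ae_le (ae_restrict_mem measurableSet_ball)
  have hfg : ∀ n, f n =ᵐ[dA α] g n := fun n => by
    filter_upwards [hfk n, hball] with z hz hzb
    rw [hz, hgk n hzb]
  have hcau : ∀ r : ℝ, 0 < r → r < 1 → UniformCauchySeqOn g atTop (closedBall 0 r) := by
    intro r hr hr1
    obtain ⟨C, hC, hb⟩ := norm_le_of_mem_harmonicSubspace α hα hr hr1
    rw [Metric.uniformCauchySeqOn_iff]
    intro ε hε
    obtain ⟨N, hN⟩ := Metric.cauchySeq_iff.1 hlim.cauchySeq (ε / (C + 1)) (by positivity)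
    refine ⟨N, fun m hm n hn z hz => ?_⟩
    have h1 := hb (f m - f n) (g m - g n) ((hgh m).sub (hgh n)) ((hgm m).sub (hgm n))
      ((Lp.coeFn_sub _ _).trans ((hfg m).sub (hfg n))) z hz
    have h2 := hN m hm n hn
    rw [dist_eq_norm] at h2 ⊢
    calc _ ≤ C * ‖f m - f n‖ := h1
      _ ≤ C * (ε / (C + 1)) := by gcongr
      _ < (C + 1) * (ε / (C + 1)) := by
          have : 0 < ε / (C + 1) := by positivity
          nlinarith
      _ = ε := by field_simp
  have hpt : ∀ z ∈ ball (0 : ℂ) 1, ∃ r : ℝ, 0 < r ∧ r < 1 ∧ z ∈ ball (0 : ℂ) r := by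
    intro z hz
    have h1 : ‖z‖ < 1 := by simpa using hz
    refine ⟨(‖z‖ + 1) / 2, by positivity, by linarith, ?_⟩
    rw [mem_ball_zero_iff]
    linarith
  have hlimz : ∀ z, ∃ y, z ∈ ball (0 : ℂ) 1 → Tendsto (fun n => g n z) atTop (𝓝 y) := by
    intro z
    by_cases hz : z ∈ ball (0 : ℂ) 1
    · obtain ⟨r, hr, hr1, hzr⟩ := hpt z hz
      obtain ⟨y, hy⟩ := cauchySeq_tendsto_of_complete
        ((hcau r hr hr1).cauchySeq (ball_subset_closedBall hzr))
      exact ⟨y, fun _ => hy⟩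
    · exact ⟨0, fun h => absurd h hz⟩
  choose G hG using hlimz
  refine ⟨G, fun z hz => ?_, ?_⟩
  · obtain ⟨r, hr, hr1, hzr⟩ := hpt z hz
    have hsub : closedBall (0 : ℂ) r ⊆ ball 0 1 := closedBall_subset_ball hr1
    exact harmonicOnNhd_of_tendstoUniformlyOn hr (fun n => (hgh n).mono hsub)
      ((hcau r hr hr1).tendstoUniformlyOn_of_tendsto fun w hw => hG w (hsub hw)) z hzr
  · obtain ⟨ns, hns, hae⟩ := (tendstoInMeasure_of_tendsto_Lp hlim).exists_seq_tendsto_ae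
    filter_upwards [hae, ae_all_iff.2 hfg, hball] with z h1 h2 h3
    simp_rw [h2] at h1
    exact tendsto_nhds_unique h1 ((hG z h3).comp hns.tendsto_atTop)

instance (α : ℝ) : (harmonicSubspace α).HasOrthogonalProjection :=
  haveI : CompleteSpace (harmonicSubspace α) :=
    (isClosed_harmonicSubspace α).completeSpace_coe
  inferInstance


/-- The orthogonal projection `ℙ_α` of `L²(𝔻, dA_α)` onto `ℋ²_α(𝔻)`. -/
def harmonicProj (α : ℝ) : L2 α →L[ℂ] L2 α := (harmonicSubspace α).starProjection

/-- The (possibly unbounded) operator of multiplication by `φ` on `L²(𝔻, dA_α)`, with its maximal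
domain `{f | φ f ∈ L²(𝔻, dA_α)}`. -/
def mulOp (α : ℝ) (φ : ℂ → ℂ) : L2 α →ₗ.[ℂ] L2 α where
  domain :=
    { carrier := {f | MemLp (fun z => φ z * f z) 2 (dA α)}
      add_mem' := by
        intro f g hf hg
        refine (memLp_congr_ae ?_).1 (hf.add hg)
        filter_upwards [Lp.coeFn_add f g] with z hz
        simp only [Pi.add_apply] at hz ⊢
        rw [hz, mul_add]
      zero_mem' := by
        refine (memLp_congr_ae ?_).1 (MemLp.zero' (ε := ℂ))
        filter_upwards [Lp.coeFn_zero ℂ 2 (dA α)] with z hz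
        rw [hz, Pi.zero_apply, mul_zero]
      smul_mem' := by
        intro c f hf
        refine (memLp_congr_ae ?_).1 (hf.const_smul c)
        filter_upwards [Lp.coeFn_smul c f] with z hz
        simp [hz, mul_left_comm] }
  toFun :=
    { toFun := fun f => MemLp.toLp (fun z => φ z * (f : L2 α) z) f.2
      map_add' := by
        intro f g
        apply Lp.ext
        refine (MemLp.coeFn_toLp _).trans ?_
        refine Filter.EventuallyEq.trans ?_ (Lp.coeFn_add _ _).symm
        filter_upwards [Lp.coeFn_add (f : L2 α) (g : L2 α), MemLp.coeFn_toLp f.2,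
          MemLp.coeFn_toLp g.2] with z hz h1 h2
        simp only [Pi.add_apply] at hz ⊢
        rw [h1, h2, ← mul_add, ← hz]
        rfl
      map_smul' := by
        intro c f
        apply Lp.ext
        refine (MemLp.coeFn_toLp _).trans ?_
        refine Filter.EventuallyEq.trans ?_ (Lp.coeFn_smul _ _).symm
        filter_upwards [Lp.coeFn_smul c (f : L2 α), MemLp.coeFn_toLp f.2] with z hz h1
        simp only [Pi.smul_apply, RingHom.id_apply]
        rw [h1]
        simp [hz, mul_left_comm] }

section Operators

variable {E : Type*} [NormedAddCommGroup E] [InnerProductSpace ℂ E]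

/-- The composition `A ∘ P` of an unbounded operator `A` with a bounded operator `P`, on its
natural domain `{f | P f ∈ dom A}`. -/
def compBounded (A : E →ₗ.[ℂ] E) (P : E →L[ℂ] E) : E →ₗ.[ℂ] E where
  domain := A.domain.comap (P : E →ₗ[ℂ] E)
  toFun :=
    { toFun := fun f => A ⟨P f, f.2⟩
      map_add' := by
        intro f g
        rw [← A.map_add]
        congr 1
        ext
        simp
      map_smul' := by
        intro c f
        rw [RingHom.id_apply, ← A.map_smul]
        congr 1
        ext
        simp }

/-- The composition `P ∘ A` of a bounded operator `P` with an unbounded operator `A`, on its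
natural domain `dom A`. -/
def boundedComp (P : E →L[ℂ] E) (A : E →ₗ.[ℂ] E) : E →ₗ.[ℂ] E :=
  (P : E →ₗ[ℂ] E).compPMap A

/-- The unbounded operator `A` and the bounded operator `P` commute: `P A ⊆ A P`, that is, for
every `f ∈ dom A` one has `P f ∈ dom A` and `A (P f) = P (A f)`. -/
def Commutes (A : E →ₗ.[ℂ] E) (P : E →L[ℂ] E) : Prop :=
  boundedComp P A ≤ compBounded A P

/-- The commutator `[A, P] = A P - P A`, on its natural domain
`{f ∈ dom A | P f ∈ dom A}`. -/
def commutator (A : E →ₗ.[ℂ] E) (P : E →L[ℂ] E) : E →ₗ.[ℂ] E :=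
  compBounded A P - boundedComp P A

variable [CompleteSpace E]

/-- The singular values of a compact operator `T`: `singularValue T n` (with `n = 0, 1, …`) is the
`n`-th term of the sequence of the eigenvalues of `|T| = (T* T) ^ (1/2)`, repeated according to
multiplicity and arranged in non-increasing order (and continued by zeros if `T` has finite
rank). In other words it is the least `t ≥ 0` such that at most `n` eigenvalues of `|T|`, counted
with multiplicity, are greater than `t`. -/
def singularValue (T : E →L[ℂ] E) (n : ℕ) : ℝ :=
  sInf {t : ℝ | 0 ≤ t ∧
    Module.rank ℂ ↥(⨆ s ∈ Set.Ioi t,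
      Module.End.eigenspace ((CFC.abs T : E →L[ℂ] E) : E →ₗ[ℂ] E) (s : ℂ)) ≤ n}

/-- The von Neumann–Schatten class `𝒞_p`: compact operators with `p`-summable singular values. -/
def IsSchatten (p : ℝ) (T : E →L[ℂ] E) : Prop :=
  IsCompactOperator T ∧ Summable (fun n => singularValue T n ^ p)

/-- A densely defined operator `C` belongs to `𝒞_p` when its (unique) continuous extension to the
whole space exists and belongs to `𝒞_p`. -/
def IsDenselyDefinedSchatten (p : ℝ) (C : E →ₗ.[ℂ] E) : Prop :=
  Dense (C.domain : Set E) ∧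
    ∃ T : E →L[ℂ] E, (∀ f : C.domain, T f = C f) ∧ IsSchatten p T

end Operators

/-- `u : Ω → [-∞, ∞)` is subharmonic on the open set `Ω`: it is upper semicontinuous and it lies
below every harmonic function that dominates it on the boundary of a closed disk contained
in `Ω`. -/
structure SubharmonicOn (u : ℂ → EReal) (Ω : Set ℂ) : Prop where
  lt_top : ∀ z ∈ Ω, u z < ⊤
  upperSemicontinuousOn : UpperSemicontinuousOn u Ω
  le_harmonic : ∀ (c : ℂ) (r : ℝ), 0 < r → closedBall c r ⊆ Ω →
    ∀ h : ℂ → ℝ, HarmonicContOnCl h (ball c r) →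
      (∀ z ∈ sphere c r, u z ≤ (h z : EReal)) → ∀ z ∈ ball c r, u z ≤ (h z : EReal)

/-- The extended-real-valued function `u` is a (finite) harmonic function on `Ω`. -/
def ERealHarmonicOn (u : ℂ → EReal) (Ω : Set ℂ) : Prop :=
  ∃ h : ℂ → ℝ, HarmonicOnNhd h Ω ∧ ∀ z ∈ Ω, u z = (h z : EReal)

/-- The operator `M_u` of multiplication by `u` on `L²(𝔻, dA_α)`. The value of `u` on a null set
is irrelevant, in particular where it is `-∞`. -/
def Mu (α : ℝ) (u : ℂ → EReal) : L2 α →ₗ.[ℂ] L2 α :=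
  mulOp α (fun z => ((u z).toReal : ℂ))

/-- The commutator `𝒞_u = M_u ℙ_α - ℙ_α M_u`. -/
def Cu (α : ℝ) (u : ℂ → EReal) : L2 α →ₗ.[ℂ] L2 α :=
  commutator (Mu α u) (harmonicProj α)

end

end HarmonicCommutator

/-! Structure of the symbol. Upper semicontinuity bounds `u` above near `0`, so Bôcher's theorem
gives `u = c log |z| + h` off the origin, with `h` harmonic on the whole disk of radius `R > 1`
(`SubharmonicOn.exists_log_add_harmonic`). The logarithm is square-integrable and is bounded away
from `0`, while harmonic functions are bounded near `0`. Hence `B = M_u ℙ` is defined everywhere and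
bounded.

Schatten classes. As `u` is real, `B*` agrees with `ℙ M_u` on the domain of `M_u`, and the
commutator is a restriction of `A - A*` with the Hankel-type operator `A = (1 - ℙ) B`
(`commutator_apply_eq`). The normalised harmonic monomials, indexed by `k ∈ ℤ`, form a Hilbert basis
of the harmonic subspace. Multiplying the `k`-th by the `j`-th yields the `(j + k)`-th up to an
error of size `|j| (1 - |z|²) |z| ^ (|k| - |j|)`, and `1 - ℙ` kills the harmonic monomial.
Multiplying by `log |z|` also yields a factor `1 - |z|²`. In `L²` this factor is worth `O(1 / |k|)`,
by a comparison of radial moments (`radialMoment_add_two_le`). Errors of different angular frequency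
are orthogonal, so `A` is `O(1 / N)` off the span of the monomials with `|k| < N`. The expansion of
`h` is summed over `j`, its coefficients decaying geometrically because `R > 1`. Thus `A - A*` is
within `O(1 / N)` of rank `4 N`, the singular values are `O(1 / n)`, and every `p > 1` is admissible
(`isSchatten_sub_adjoint`).

Commutation. Applied to the constant `1`, commutation makes `u` agree almost everywhere with a
harmonic function, which forces `c = 0`. Applied to `u` itself, it makes `h²` harmonic. Then `(h - h
0)²` is a nonnegative harmonic function vanishing at `0`, so it vanishes (`eq_const_of_commutes`).
The value `u 0` is recovered from subharmonicity. -/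

namespace HarmonicCommutator

open MeasureTheory InnerProductSpace Metric Filter Topology
open scoped ENNReal

/-! ### Singular values, approximation by finite rank, and Schatten classes. -/

section Operators

variable {E : Type*} [NormedAddCommGroup E] [InnerProductSpace ℂ E]

/-- On the span of the eigenspaces of a symmetric operator for eigenvalues above `t`, the operator
expands norms by more than `t`. -/
theorem lt_norm_apply_of_mem_iSup_eigenspace {S : E →ₗ[ℂ] E} (hS : S.IsSymmetric) {t : ℝ}
    (ht : 0 ≤ t) {x : E} (hx : x ∈ ⨆ s ∈ Set.Ioi t, Module.End.eigenspace S (s : ℂ))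
    (hx0 : x ≠ 0) : t * ‖x‖ < ‖S x‖ := by
  rw [iSup_subtype', Submodule.mem_iSup_iff_exists_finsupp] at hx
  obtain ⟨f, hf, rfl⟩ := hx
  have hO : OrthogonalFamily ℂ (fun s : Set.Ioi t => Module.End.eigenspace S ((s : ℝ) : ℂ))
      fun s => (Module.End.eigenspace S ((s : ℝ) : ℂ)).subtypeₗᵢ :=
    hS.orthogonalFamily_eigenspaces.comp (γ := Set.Ioi t) (f := fun s => ((s : ℝ) : ℂ)) (fun a b hab => by
      apply Subtype.ext
      exact Complex.ofReal_injective hab)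
  have e1 : ‖f.sum fun _ x => x‖ ^ 2 = ∑ s ∈ f.support, ‖f s‖ ^ 2 :=
    hO.norm_sum (fun s => ⟨f s, hf s⟩) f.support
  have e2 : ‖S (f.sum fun _ x => x)‖ ^ 2 = ∑ s ∈ f.support, ((s : ℝ) * ‖f s‖) ^ 2 := by
    have := hO.norm_sum (fun s => ((s : ℝ) : ℂ) • ⟨f s, hf s⟩) f.support
    have e3 : S (f.sum fun _ x => x) = ∑ s ∈ f.support, ((s : ℝ) : ℂ) • f s := by
      rw [Finsupp.sum, map_sum]
      exact Finset.sum_congr rfl fun s _ => Module.End.mem_eigenspace_iff.1 (hf s)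
    rw [e3]
    refine this.trans (Finset.sum_congr rfl fun s _ => ?_)
    have hs : (0 : ℝ) ≤ s := ht.trans (le_of_lt s.2)
    rw [norm_smul, Complex.norm_real, Real.norm_of_nonneg hs]
    rfl
  have hne : f.support.Nonempty := by
    rw [Finsupp.support_nonempty_iff]
    rintro rfl
    exact hx0 (by simp)
  refine lt_of_pow_lt_pow_left₀ 2 (norm_nonneg _) ?_
  rw [e2, mul_pow, e1, Finset.mul_sum]
  refine Finset.sum_lt_sum_of_nonempty hne fun s hs => ?_
  rw [mul_pow]
  have h1 : 0 < ‖f s‖ := norm_pos_iff.2 (Finsupp.mem_support_iff.1 hs)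
  have h2 : t < s := s.2
  gcongr

theorem isCompactOperator_of_finiteDimensional_range (F : E →L[ℂ] E)
    [FiniteDimensional ℂ (LinearMap.range (F : E →ₗ[ℂ] E))] : IsCompactOperator F := by
  have : ProperSpace (LinearMap.range (F : E →ₗ[ℂ] E)) := FiniteDimensional.proper ℂ _
  have h := (isCompactOperator_of_locallyCompactSpace_dom
    (F.codRestrict _ fun x => LinearMap.mem_range_self (F : E →ₗ[ℂ] E) x))
  exact h.clm_comp (LinearMap.range (F : E →ₗ[ℂ] E)).subtypeL

variable [CompleteSpace E]

/-- Both squared norms are the quadratic form of `|T|² = T* T`. This transfers eigenspace estimates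
for `|T|` to `T` without a polar decomposition. -/
theorem norm_abs_apply (T : E →L[ℂ] E) (x : E) : ‖(CFC.abs T : E →L[ℂ] E) x‖ = ‖T x‖ := by
  set S : E →L[ℂ] E := CFC.abs T
  have hS : IsSelfAdjoint S := IsSelfAdjoint.of_nonneg (CFC.abs_nonneg T)
  have h1 : star S * S = star T * T := by
    rw [hS.star_eq]
    exact CFC.abs_mul_abs T
  have h2 : ∀ A : E →L[ℂ] E, ((‖A x‖ ^ 2 : ℝ) : ℂ) = inner ℂ ((star A * A) x) x := by
    intro A
    rw [ContinuousLinearMap.star_eq_adjoint, mul_apply_eq_comp,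
      ContinuousLinearMap.adjoint_inner_left, inner_self_eq_norm_sq_to_K]
    push_cast
    rfl
  have h3 : ‖S x‖ ^ 2 = ‖T x‖ ^ 2 := by
    have := (h2 S).trans ((congrArg (fun A : E →L[ℂ] E => inner ℂ (A x) x) h1).trans (h2 T).symm)
    exact_mod_cast this
  exact (sq_eq_sq₀ (norm_nonneg _) (norm_nonneg _)).1 h3

theorem singularValue_nonneg (T : E →L[ℂ] E) (n : ℕ) : 0 ≤ singularValue T n :=
  Real.sInf_nonneg fun _ ht => ht.1

/-- Singular values are bounded by approximation numbers. -/
theorem singularValue_le_norm_sub (T F : E →L[ℂ] E) (n : ℕ)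
    (hF : Module.rank ℂ (LinearMap.range (F : E →ₗ[ℂ] E)) ≤ n) :
    singularValue T n ≤ ‖T - F‖ := by
  refine csInf_le ⟨0, fun _ ht => ht.1⟩ ⟨norm_nonneg _, ?_⟩
  set W := ⨆ s ∈ Set.Ioi ‖T - F‖,
      Module.End.eigenspace ((CFC.abs T : E →L[ℂ] E) : E →ₗ[ℂ] E) (s : ℂ) with hW
  have hS : (((CFC.abs T : E →L[ℂ] E) : E →ₗ[ℂ] E)).IsSymmetric :=
    (IsSelfAdjoint.of_nonneg (CFC.abs_nonneg T)).isSymmetric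
  -- `F` is injective on `W`: a vector of `W` killed by `F` satisfies `‖T x‖ ≤ ‖T - F‖ ‖x‖`, whereas
  -- `|T|` expands nonzero vectors of `W` by strictly more than `‖T - F‖`.
  refine le_trans (LinearMap.rank_le_of_injective
    ((F : E →ₗ[ℂ] E).rangeRestrict ∘ₗ W.subtype) ?_) hF
  rw [← LinearMap.ker_eq_bot, LinearMap.ker_eq_bot']
  rintro ⟨x, hx⟩ h0
  by_contra hne
  have hx0 : x ≠ 0 := fun h => hne (Subtype.ext h)
  have h1 := lt_norm_apply_of_mem_iSup_eigenspace hS (norm_nonneg _) hx hx0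
  have hFx : F x = 0 := by simpa using congrArg Subtype.val h0
  have h2 : ‖T x‖ ≤ ‖T - F‖ * ‖x‖ := by
    have := (T - F).le_opNorm x
    rwa [sub_apply, hFx, sub_zero] at this
  rw [ContinuousLinearMap.coe_coe, norm_abs_apply] at h1
  exact absurd h1 (not_lt.2 h2)

/-- An operator whose distance to the operators of rank at most `4 N` is `O(1 / N)` belongs to all
the classes `𝒞_p` with `p > 1`. -/
theorem isSchatten_of_norm_sub_le {T : E →L[ℂ] E} {C : ℝ}
    (h : ∀ N : ℕ, ∃ F : E →L[ℂ] E, Module.rank ℂ (LinearMap.range (F : E →ₗ[ℂ] E)) ≤ (4 * N : ℕ) ∧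
      ‖T - F‖ ≤ C / (N + 1)) {p : ℝ} (hp : 1 < p) : IsSchatten p T := by
  choose F hr hF using h
  have hC : 0 ≤ C := by simpa using (norm_nonneg _).trans (hF 0)
  constructor
  · refine isCompactOperator_of_tendsto (l := atTop) (F := F) ?_ (Eventually.of_forall fun N => ?_)
    · rw [tendsto_iff_norm_sub_tendsto_zero]
      refine squeeze_zero (fun _ => norm_nonneg _) (fun N => ?_)
        ((tendsto_const_div_atTop_nhds_zero_nat C).comp (tendsto_add_atTop_nat 1))
      rw [norm_sub_rev]
      simpa using hF N
    · have : FiniteDimensional ℂ (LinearMap.range (F N : E →ₗ[ℂ] E)) :=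
        Module.rank_lt_aleph0_iff.1 ((hr N).trans_lt (Cardinal.natCast_lt_aleph0))
      exact isCompactOperator_of_finiteDimensional_range (F N)
  · have hs : ∀ n : ℕ, singularValue T n ≤ 4 * C / ((n : ℝ) + 1) := by
      intro n
      -- The integer quotient is chosen so that the rank bound `4 * (n / 4)` does not exceed `n`, at
      -- the cost of a factor `4` in the constant.
      have h1 : singularValue T n ≤ ‖T - F (n / 4)‖ :=
        singularValue_le_norm_sub _ _ _ ((hr _).trans (by
          exact_mod_cast Nat.mul_div_le n 4))
      refine h1.trans ((hF _).trans ?_)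
      rw [div_le_div_iff₀ (by positivity) (by positivity)]
      have h2 : n + 1 ≤ 4 * (n / 4 + 1) := by omega
      have h3 : ((n : ℝ) + 1) ≤ 4 * ((n / 4 : ℕ) + 1) := by exact_mod_cast h2
      nlinarith
    have hsum : Summable fun n : ℕ => (4 * C) ^ p * ((((n : ℝ) + 1) ^ p)⁻¹) := by
      refine Summable.mul_left _ ?_
      have := (summable_nat_add_iff 1).2 (Real.summable_nat_rpow_inv.2 hp)
      simpa using this
    refine hsum.of_nonneg_of_le (fun n => Real.rpow_nonneg (singularValue_nonneg _ _) _) fun n => ?_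
    calc singularValue T n ^ p ≤ (4 * C / ((n : ℝ) + 1)) ^ p :=
          Real.rpow_le_rpow (singularValue_nonneg _ _) (hs n) (by linarith)
      _ = _ := by rw [Real.div_rpow (by positivity) (by positivity), div_eq_mul_inv]

/-- A bounded operator that is `O(1 / N)` off subspaces of dimension at most `2 N` differs from its
adjoint by an operator in all the classes `𝒞_p` with `p > 1`. -/
theorem isSchatten_sub_adjoint {A : E →L[ℂ] E} {C : ℝ}
    (h : ∀ N : ℕ, ∃ U : Submodule ℂ E, ∃ _ : FiniteDimensional ℂ U,
      Module.finrank ℂ U ≤ 2 * N ∧ ∀ x ∈ Uᗮ, ‖A x‖ ≤ C / (N + 1) * ‖x‖)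
    {p : ℝ} (hp : 1 < p) : IsSchatten p (A - ContinuousLinearMap.adjoint A) := by
  refine isSchatten_of_norm_sub_le (C := 2 * |C|) (fun N => ?_) hp
  obtain ⟨U, hU, hd, hA⟩ := h N
  have hrU : Module.rank ℂ U ≤ (2 * N : ℕ) := by
    rw [← Module.finrank_eq_rank]
    exact_mod_cast hd
  set Q : E →L[ℂ] E := U.starProjection with hQ
  have hQa : ContinuousLinearMap.adjoint Q = Q := by
    rw [← ContinuousLinearMap.star_eq_adjoint]
    exact (isSelfAdjoint_starProjection U).star_eq
  have hrQ : LinearMap.range (Q : E →ₗ[ℂ] E) = U := Submodule.range_starProjection U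
  have hn : ‖A - A ∘L Q‖ ≤ |C| / (N + 1) := by
    refine ContinuousLinearMap.opNorm_le_bound _ (by positivity) fun x => ?_
    have h1 : (A - A ∘L Q) x = A (x - Q x) := by simp
    have h2 : ‖x - Q x‖ ≤ ‖x‖ := by
      have := Submodule.norm_starProjection_apply_le Uᗮ x
      rwa [Submodule.starProjection_orthogonal_val] at this
    rw [h1]
    calc _ ≤ C / (N + 1) * ‖x - Q x‖ := hA _ (Submodule.sub_starProjection_mem_orthogonal x)
      _ ≤ |C| / (N + 1) * ‖x‖ := by
        gcongr
        exact le_abs_self C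
  -- Cutting `A` off by the projection onto `U` keeps the antisymmetric form. The range lies in `A U
  -- + U`, whence rank at most `4 N`, and each of the two remainders has norm at most `|C| / (N +
  -- 1)`.
  refine ⟨A ∘L Q - ContinuousLinearMap.adjoint (A ∘L Q), ?_, ?_⟩
  · have h1 : LinearMap.range ((A ∘L Q - ContinuousLinearMap.adjoint (A ∘L Q) : E →L[ℂ] E) : E →ₗ[ℂ] E)
        ≤ U.map (A : E →ₗ[ℂ] E) ⊔ U := by
      rintro _ ⟨x, rfl⟩
      rw [ContinuousLinearMap.adjoint_comp, hQa]
      refine Submodule.sub_mem_sup ?_ ?_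
      · exact ⟨Q x, Submodule.starProjection_apply_mem U x, rfl⟩
      · exact Submodule.starProjection_apply_mem U _
    refine (Submodule.rank_mono h1).trans ((Submodule.rank_add_le_rank_add_rank _ _).trans ?_)
    calc _ ≤ ((2 * N : ℕ) : Cardinal) + (2 * N : ℕ) := by
          gcongr
          exact (rank_map_le _ _).trans hrU
      _ = _ := by
        norm_cast
        ring_nf
  · have h1 : A - ContinuousLinearMap.adjoint A - (A ∘L Q - ContinuousLinearMap.adjoint (A ∘L Q)) =
        (A - A ∘L Q) - ContinuousLinearMap.adjoint (A - A ∘L Q) := by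
      rw [map_sub]
      abel
    rw [h1]
    refine (norm_sub_le _ _).trans ?_
    rw [LinearIsometryEquiv.norm_map]
    calc _ ≤ |C| / (N + 1) + |C| / (N + 1) := by gcongr
      _ = _ := by ring

end Operators

/-! ### Radial moments of the weight. -/

section Moments

/-- The radial moments `∫₀¹ r ^ (2 n + 1) (1 - r²) ^ β dr`. -/
noncomputable def radialMoment (β : ℝ) (n : ℕ) : ℝ :=
  ∫ r in (0 : ℝ)..1, r ^ (2 * n + 1) * (1 - r ^ 2) ^ β

/-- Since `1 - r² = (1 + r) (1 - r)`, the only singularity is that of `(1 - r) ^ β` at `1`,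
integrable because `β > -1`. -/
theorem intervalIntegrable_pow_mul_one_sub_sq_rpow {β : ℝ} (hβ : -1 < β) (m : ℕ) :
    IntervalIntegrable (fun r : ℝ => r ^ m * (1 - r ^ 2) ^ β) volume 0 1 := by
  have h1 : IntervalIntegrable (fun r : ℝ => (1 - r) ^ β) volume 0 1 := by
    have := (intervalIntegral.intervalIntegrable_rpow' (a := 0) (b := 1) hβ).comp_sub_left 1
    simpa using this.symm
  have h2 : ContinuousOn (fun r : ℝ => r ^ m * (1 + r) ^ β) (Set.uIcc 0 1) := by
    rw [Set.uIcc_of_le zero_le_one]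
    refine ContinuousOn.mul (by fun_prop) (ContinuousOn.rpow_const (by fun_prop) fun x hx => ?_)
    have := hx.1
    exact Or.inl (by positivity)
  refine (h1.continuousOn_mul h2).congr fun r hr => ?_
  rw [Set.uIoc_of_le zero_le_one] at hr
  have h3 : 1 - r ^ 2 = (1 + r) * (1 - r) := by ring
  rw [h3, Real.mul_rpow (by linarith [hr.1]) (by linarith [hr.2]), mul_assoc]

/-- Integrate the derivative of `r ^ (2 n + 2) (1 - r²) ^ (β + 1)`, a function that vanishes at both
endpoints. -/
theorem radialMoment_by_parts {β : ℝ} (hβ : -1 < β) (n : ℕ) :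
    (n + 1) * radialMoment (β + 1) n = (β + 1) * radialMoment β (n + 1) := by
  have hd : ∀ r ∈ Set.Ioo (0 : ℝ) 1, HasDerivAt (fun r : ℝ => r ^ (2 * n + 2) * (1 - r ^ 2) ^ (β + 1))
      (2 * (n + 1) * (r ^ (2 * n + 1) * (1 - r ^ 2) ^ (β + 1)) -
        2 * (β + 1) * (r ^ (2 * (n + 1) + 1) * (1 - r ^ 2) ^ β)) r := by
    intro r hr
    have h0 : 1 - r ^ 2 ≠ 0 := by
      have := hr.1; have := hr.2
      nlinarith
    have h1 : HasDerivAt (fun r : ℝ => 1 - r ^ 2) (-(2 * r)) r := by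
      simpa using (hasDerivAt_pow 2 r).const_sub 1
    have h2 := h1.rpow_const (p := β + 1) (Or.inl h0)
    have h3 := (hasDerivAt_pow (2 * n + 2) r).mul h2
    refine h3.congr_deriv ?_
    rw [add_sub_cancel_right]
    push_cast
    ring
  have hc : ContinuousOn (fun r : ℝ => r ^ (2 * n + 2) * (1 - r ^ 2) ^ (β + 1)) (Set.Icc 0 1) :=
    ContinuousOn.mul (by fun_prop) (ContinuousOn.rpow_const (by fun_prop)
      fun x hx => Or.inr (by linarith))
  have i1 := intervalIntegrable_pow_mul_one_sub_sq_rpow (β := β + 1) (by linarith) (2 * n + 1)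
  have i2 := intervalIntegrable_pow_mul_one_sub_sq_rpow hβ (2 * (n + 1) + 1)
  have h := intervalIntegral.integral_eq_sub_of_hasDerivAt_of_le zero_le_one hc hd
    ((i1.const_mul _).sub (i2.const_mul _))
  rw [intervalIntegral.integral_sub (i1.const_mul _) (i2.const_mul _),
    intervalIntegral.integral_const_mul, intervalIntegral.integral_const_mul] at h
  simp only [one_pow, sub_self, Real.zero_rpow (by linarith : β + 1 ≠ 0), mul_zero] at h
  rw [zero_pow (by omega), zero_mul] at h
  simp only [radialMoment]
  linarith

theorem radialMoment_nonneg (β : ℝ) (n : ℕ) : 0 ≤ radialMoment β n := by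
  refine intervalIntegral.integral_nonneg zero_le_one fun r hr => ?_
  have h1 := hr.1
  have h2 : 0 ≤ 1 - r ^ 2 := by nlinarith [hr.2]
  positivity

/-- The difference of two consecutive moments carries an extra factor `1 - r²`, so it is a moment
for `β + 1`, and integration by parts brings it back to `β`. -/
theorem radialMoment_succ {β : ℝ} (hβ : -1 < β) (n : ℕ) :
    radialMoment β n = (1 + (β + 1) / (n + 1)) * radialMoment β (n + 1) := by
  have i1 := intervalIntegrable_pow_mul_one_sub_sq_rpow hβ (2 * n + 1)
  have i2 := intervalIntegrable_pow_mul_one_sub_sq_rpow hβ (2 * (n + 1) + 1)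
  have h1 : radialMoment β n - radialMoment β (n + 1) = radialMoment (β + 1) n := by
    rw [radialMoment, radialMoment, ← intervalIntegral.integral_sub i1 i2]
    refine intervalIntegral.integral_congr_ae ?_
    have h1 : ∀ᵐ r : ℝ, r ≠ 1 := by simp [ae_iff]
    filter_upwards [h1] with r hr hr'
    rw [Set.uIoc_of_le zero_le_one] at hr'
    have h2 : 1 - r ^ 2 ≠ 0 := by
      have := lt_of_le_of_ne hr'.2 hr
      nlinarith [hr'.1]
    rw [Real.rpow_add_one h2]
    ring
  have h2 := radialMoment_by_parts hβ n
  have h3 : radialMoment (β + 1) n = (β + 1) / (n + 1) * radialMoment β (n + 1) := by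
    field_simp
    linarith
  linarith

theorem radialMoment_le_succ {β : ℝ} (hβ : -1 < β) (n : ℕ) :
    radialMoment β (n + 1) ≤ radialMoment β n := by
  rw [radialMoment_succ hβ n]
  have h1 : 0 ≤ (β + 1) / (n + 1) := div_nonneg (by linarith) (by positivity)
  nlinarith [radialMoment_nonneg β (n + 1)]

theorem radialMoment_antitone {β : ℝ} (hβ : -1 < β) : Antitone (radialMoment β) :=
  antitone_nat_of_succ_le (radialMoment_le_succ hβ)

theorem radialMoment_zero {β : ℝ} (hβ : -1 < β) : radialMoment β 0 = 1 / (2 * (β + 1)) := by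
  have hd : ∀ r ∈ Set.Ioo (0 : ℝ) 1, HasDerivAt (fun r : ℝ => -(1 - r ^ 2) ^ (β + 1) / (2 * (β + 1)))
      (r ^ (2 * 0 + 1) * (1 - r ^ 2) ^ β) r := by
    intro r hr
    have h0 : 1 - r ^ 2 ≠ 0 := by
      have := hr.1; have := hr.2
      nlinarith
    have h1 : HasDerivAt (fun r : ℝ => 1 - r ^ 2) (-(2 * r)) r := by
      simpa using (hasDerivAt_pow 2 r).const_sub 1
    have h2 := ((h1.rpow_const (p := β + 1) (Or.inl h0)).neg).div_const (2 * (β + 1))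
    refine h2.congr_deriv ?_
    have : β + 1 ≠ 0 := by linarith
    rw [add_sub_cancel_right]
    field_simp
    ring
  have hc : ContinuousOn (fun r : ℝ => -(1 - r ^ 2) ^ (β + 1) / (2 * (β + 1))) (Set.Icc 0 1) :=
    ((ContinuousOn.rpow_const (by fun_prop) fun x hx => Or.inr (by linarith)).neg).div_const _
  have h := intervalIntegral.integral_eq_sub_of_hasDerivAt_of_le zero_le_one hc hd
    (intervalIntegrable_pow_mul_one_sub_sq_rpow hβ (2 * 0 + 1))
  rw [radialMoment, h]
  simp [Real.zero_rpow (by linarith : β + 1 ≠ 0)]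
  field_simp

theorem radialMoment_pos {β : ℝ} (hβ : -1 < β) (n : ℕ) : 0 < radialMoment β n := by
  induction n with
  | zero =>
    rw [radialMoment_zero hβ]
    have : 0 < β + 1 := by linarith
    positivity
  | succ n ih =>
    rw [radialMoment_succ hβ n] at ih
    have h1 : 0 ≤ (β + 1) / (n + 1) := div_nonneg (by linarith) (by positivity)
    exact pos_of_mul_pos_right ih (by linarith)

/-- Each of the `j` consecutive ratios is at most `1 + (β + 1) / (k + 1) ≤ exp ((β + 1) / (k + 1))`.
Consequently moments whose orders differ by a bounded factor are comparable. -/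
theorem radialMoment_le_exp_mul {β : ℝ} (hβ : -1 < β) (k j : ℕ) :
    radialMoment β k ≤ Real.exp ((β + 1) * j / (k + 1)) * radialMoment β (k + j) := by
  induction j with
  | zero => simp
  | succ j ih =>
    have h0 : 0 ≤ (β + 1) / (k + 1) := div_nonneg (by linarith) (by positivity)
    have h1 : radialMoment β (k + j) ≤ Real.exp ((β + 1) / (k + 1)) * radialMoment β (k + j + 1) := by
      rw [radialMoment_succ hβ]
      refine mul_le_mul_of_nonneg_right ?_ (radialMoment_nonneg _ _)
      have h2 : (β + 1) / (((k + j : ℕ) : ℝ) + 1) ≤ (β + 1) / (k + 1) := by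
        refine div_le_div_of_nonneg_left (by linarith) (by positivity) ?_
        push_cast
        linarith [(Nat.cast_nonneg j : (0 : ℝ) ≤ j)]
      linarith [Real.add_one_le_exp ((β + 1) / (k + 1))]
    calc _ ≤ _ := ih
      _ ≤ Real.exp ((β + 1) * j / (k + 1)) * (Real.exp ((β + 1) / (k + 1)) *
          radialMoment β (k + j + 1)) := by gcongr
      _ = _ := by
        rw [← mul_assoc, ← Real.exp_add, ← add_assoc]
        congr 2
        push_cast
        ring

/-- The weight `(1 - r²)²` gains a factor `O(1 / n²)` on the moments of order `n`. -/
theorem radialMoment_add_two_le {α : ℝ} (hα : -1 < α) {n m : ℕ} (h : 2 * m ≤ n) :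
    radialMoment (α + 2) (n - m) ≤
      4 * (α + 1) * (α + 2) * Real.exp (α + 1) / ((n : ℝ) + 1) ^ 2 * radialMoment α n := by
  obtain ⟨k, rfl⟩ := Nat.exists_eq_add_of_le (show m ≤ n by omega)
  have hmk : m ≤ k := by omega
  rw [Nat.add_sub_cancel_left]
  have a1 : 0 < α + 1 := by linarith
  have a2 : 0 < α + 2 := by linarith
  have h1 := radialMoment_by_parts (β := α + 1) (by linarith) k
  have h2 := radialMoment_by_parts hα (k + 1)
  -- Two integrations by parts bring the exponent `α + 2` down to `α`, each gaining a factor of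
  -- order `1 / k`.
  rw [show α + 1 + 1 = α + 2 by ring] at h1
  push_cast at h2
  have h3 : radialMoment α (k + 1 + 1) ≤ radialMoment α k := radialMoment_antitone hα (by omega)
  -- As `m ≤ k`, the exponent `(α + 1) m / (k + 1)` stays below `α + 1`, so the shift by `m` costs
  -- only a constant.
  have h4 : radialMoment α k ≤ Real.exp (α + 1) * radialMoment α (m + k) := by
    refine (radialMoment_le_exp_mul hα k m).trans ?_
    rw [add_comm k m]
    refine mul_le_mul_of_nonneg_right ?_ (radialMoment_nonneg _ _)
    rw [Real.exp_le_exp, div_le_iff₀ (by positivity)]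
    have : (m : ℝ) ≤ k := by exact_mod_cast hmk
    nlinarith
  have h5 : ((k : ℝ) + 1) * (k + 1 + 1) * radialMoment (α + 2) k =
      (α + 2) * (α + 1) * radialMoment α (k + 1 + 1) := by
    linear_combination ((k : ℝ) + 1 + 1) * h1 + (α + 2) * h2
  have h6 : ((k : ℝ) + 1) ^ 2 * radialMoment (α + 2) k ≤
      (α + 2) * (α + 1) * (Real.exp (α + 1) * radialMoment α (m + k)) := by
    calc _ ≤ ((k : ℝ) + 1) * (k + 1 + 1) * radialMoment (α + 2) k := by
          refine mul_le_mul_of_nonneg_right ?_ (radialMoment_nonneg _ _)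
          nlinarith [(Nat.cast_nonneg k : (0 : ℝ) ≤ k)]
      _ ≤ _ := by
          rw [h5]
          exact mul_le_mul_of_nonneg_left (h3.trans h4) (by positivity)
  rw [div_mul_eq_mul_div, le_div_iff₀ (by positivity)]
  have h7 : (((m + k : ℕ) : ℝ) + 1) ^ 2 ≤ 4 * ((k : ℝ) + 1) ^ 2 := by
    have : (m : ℝ) ≤ k := by exact_mod_cast hmk
    push_cast
    nlinarith [(Nat.cast_nonneg k : (0 : ℝ) ≤ k), (Nat.cast_nonneg m : (0 : ℝ) ≤ m)]
  calc _ ≤ radialMoment (α + 2) k * (4 * ((k : ℝ) + 1) ^ 2) :=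
        mul_le_mul_of_nonneg_left h7 (radialMoment_nonneg _ _)
    _ ≤ 4 * ((α + 2) * (α + 1) * (Real.exp (α + 1) * radialMoment α (m + k))) := by linarith
    _ = _ := by ring

end Moments

/-! ### The weighted measure in polar coordinates and its rotation invariance. -/

section Measure

variable {α : ℝ}

theorem dA_absolutelyContinuous (α : ℝ) : dA α ≪ volume.restrict (ball (0 : ℂ) 1) :=
  withDensity_absolutelyContinuous _ _

theorem ae_dA_mem_ball (α : ℝ) : ∀ᵐ z ∂(dA α), z ∈ ball (0 : ℂ) 1 :=
  (dA_absolutelyContinuous α).ae_le (ae_restrict_mem measurableSet_ball)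

theorem ae_dA_ne_zero (α : ℝ) : ∀ᵐ z ∂(dA α), z ≠ 0 := by
  refine (dA_absolutelyContinuous α).ae_le (ae_restrict_of_ae ?_)
  simp [ae_iff]

theorem measurable_density (α : ℝ) :
    Measurable fun z : ℂ => ENNReal.ofReal ((α + 1) / Real.pi * (1 - ‖z‖ ^ 2) ^ α) := by
  fun_prop

theorem density_nonneg (hα : -1 < α) {z : ℂ} (hz : z ∈ ball (0 : ℂ) 1) :
    0 ≤ (α + 1) / Real.pi * (1 - ‖z‖ ^ 2) ^ α := by
  have h1 : ‖z‖ < 1 := by simpa using hz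
  have h2 : 0 ≤ 1 - ‖z‖ ^ 2 := by nlinarith [norm_nonneg z]
  have h3 : 0 ≤ α + 1 := by linarith
  have := Real.pi_pos
  positivity

/-- Makes the restriction to the disk part of a radial profile on the whole plane, where integration
in polar coordinates applies. -/
theorem dA_radial_aux (α : ℝ) (φ : ℝ → ℝ) (z : ℂ) :
    (ball (0 : ℂ) 1).indicator (fun z => (α + 1) / Real.pi * (1 - ‖z‖ ^ 2) ^ α * φ ‖z‖) z =
      (Set.Iio (1 : ℝ)).indicator (fun r => (α + 1) / Real.pi * (1 - r ^ 2) ^ α * φ r) ‖z‖ := by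
  by_cases hz : ‖z‖ < 1
  · rw [Set.indicator_of_mem (by simpa using hz), Set.indicator_of_mem (by simpa using hz)]
  · rw [Set.indicator_of_notMem (by simpa using hz), Set.indicator_of_notMem (by simpa using hz)]

theorem integrable_dA_radial (hα : -1 < α) {φ : ℝ → ℝ}
    (h : IntervalIntegrable (fun r => r * φ r * (1 - r ^ 2) ^ α) volume 0 1) :
    Integrable (fun z : ℂ => φ ‖z‖) (dA α) := by
  rw [dA, integrable_withDensity_iff_integrable_smul₀' (measurable_density α).aemeasurable
    (ae_of_all _ fun _ => ENNReal.ofReal_lt_top)]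
  have h1 : IntegrableOn (fun z : ℂ => (α + 1) / Real.pi * (1 - ‖z‖ ^ 2) ^ α * φ ‖z‖) (ball 0 1) := by
    rw [← integrable_indicator_iff measurableSet_ball, funext (dA_radial_aux α φ)]
    rw [integrable_fun_norm_addHaar (μ := (volume : Measure ℂ)) (f := (Set.Iio (1 : ℝ)).indicator
      (fun r => (α + 1) / Real.pi * (1 - r ^ 2) ^ α * φ r)), Complex.finrank_real_complex]
    simp only [Nat.add_one_sub_one, pow_one, smul_eq_mul]
    have h2 : (fun y : ℝ => y * (Set.Iio (1 : ℝ)).indicator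
        (fun r => (α + 1) / Real.pi * (1 - r ^ 2) ^ α * φ r) y) = (Set.Iio (1 : ℝ)).indicator
        (fun r => (α + 1) / Real.pi * (r * φ r * (1 - r ^ 2) ^ α)) := by
      ext y
      by_cases hy : y < 1
      · rw [Set.indicator_of_mem (by simpa using hy), Set.indicator_of_mem (by simpa using hy)]
        ring
      · rw [Set.indicator_of_notMem (by simpa using hy), Set.indicator_of_notMem (by simpa using hy),
          mul_zero]
    rw [h2, integrableOn_indicator_iff measurableSet_Iio, Set.inter_comm, Set.Ioi_inter_Iio]
    rw [intervalIntegrable_iff_integrableOn_Ioo_of_le zero_le_one] at h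
    exact h.const_mul _
  refine (integrableOn_congr_fun (fun z hz => ?_) measurableSet_ball).1 h1
  rw [ENNReal.toReal_ofReal (density_nonneg hα hz), smul_eq_mul]

theorem integral_dA_radial (hα : -1 < α) (φ : ℝ → ℝ) :
    ∫ z, φ ‖z‖ ∂(dA α) = 2 * (α + 1) * ∫ r in (0 : ℝ)..1, r * φ r * (1 - r ^ 2) ^ α := by
  rw [dA, integral_withDensity_eq_integral_toReal_smul (measurable_density α)
    (ae_of_all _ fun _ => ENNReal.ofReal_lt_top)]
  have h1 : ∫ z in ball (0 : ℂ) 1, (ENNReal.ofReal ((α + 1) / Real.pi * (1 - ‖z‖ ^ 2) ^ α)).toReal •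
      φ ‖z‖ = ∫ z in ball (0 : ℂ) 1, (α + 1) / Real.pi * (1 - ‖z‖ ^ 2) ^ α * φ ‖z‖ := by
    refine setIntegral_congr_fun measurableSet_ball fun z hz => ?_
    simp only [smul_eq_mul]
    rw [ENNReal.toReal_ofReal (density_nonneg hα hz)]
  rw [h1, ← integral_indicator measurableSet_ball]
  simp_rw [dA_radial_aux]
  rw [integral_fun_norm_addHaar (volume : Measure ℂ) ((Set.Iio (1 : ℝ)).indicator
      (fun r => (α + 1) / Real.pi * (1 - r ^ 2) ^ α * φ r)), Complex.finrank_real_complex]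
  have h2 : (fun y : ℝ => y ^ (2 - 1) • (Set.Iio (1 : ℝ)).indicator
        (fun r => (α + 1) / Real.pi * (1 - r ^ 2) ^ α * φ r) y) = (Set.Iio (1 : ℝ)).indicator
        (fun r => (α + 1) / Real.pi * (r * φ r * (1 - r ^ 2) ^ α)) := by
    ext y
    by_cases hy : y < 1
    · rw [Set.indicator_of_mem (by simpa using hy), Set.indicator_of_mem (by simpa using hy),
        smul_eq_mul]
      ring
    · rw [Set.indicator_of_notMem (by simpa using hy), Set.indicator_of_notMem (by simpa using hy),
        smul_zero]
  rw [h2, setIntegral_indicator measurableSet_Iio, Set.Ioi_inter_Iio, integral_const_mul,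
    ← integral_Ioc_eq_integral_Ioo, ← intervalIntegral.integral_of_le zero_le_one]
  have h3 : (volume : Measure ℂ).real (ball 0 1) = Real.pi := by
    rw [Measure.real, Complex.volume_ball]
    simp
  rw [h3]
  have := Real.pi_pos.ne'
  simp only [smul_eq_mul, nsmul_eq_mul]
  field_simp
  push_cast
  ring

theorem isFiniteMeasure_dA (hα : -1 < α) : IsFiniteMeasure (dA α) := by
  have h : Integrable (fun _ : ℂ => (1 : ℝ)) (dA α) := by
    refine integrable_dA_radial (φ := fun _ => 1) hα ?_
    simpa using intervalIntegrable_pow_mul_one_sub_sq_rpow hα 1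
  exact (integrable_const_iff_isFiniteMeasure one_ne_zero).1 h

theorem integral_dA_norm_pow (hα : -1 < α) (n : ℕ) :
    ∫ z : ℂ, ‖z‖ ^ (2 * n) ∂(dA α) = 2 * (α + 1) * radialMoment α n := by
  rw [integral_dA_radial hα (fun r => r ^ (2 * n)), radialMoment]
  congr 1
  refine intervalIntegral.integral_congr fun r _ => ?_
  ring

theorem integral_dA_sq_mul_norm_pow (hα : -1 < α) (n : ℕ) :
    ∫ z : ℂ, (1 - ‖z‖ ^ 2) ^ 2 * ‖z‖ ^ (2 * n) ∂(dA α) = 2 * (α + 1) * radialMoment (α + 2) n := by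
  rw [integral_dA_radial hα (fun r => (1 - r ^ 2) ^ 2 * r ^ (2 * n)), radialMoment]
  congr 1
  refine intervalIntegral.integral_congr_ae ?_
  have h1 : ∀ᵐ r : ℝ, r ≠ 1 := by simp [ae_iff]
  filter_upwards [h1] with r hr hr'
  rw [Set.uIoc_of_le zero_le_one] at hr'
  have h2 : 1 - r ^ 2 ≠ 0 := by
    have := lt_of_le_of_ne hr'.2 hr
    nlinarith [hr'.1]
  rw [show (2 : ℝ) = (2 : ℕ) by norm_num, Real.rpow_add_natCast h2]
  ring

/-- Rotations preserve Lebesgue measure and the disk, and the density depends on `|z|` alone. All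
orthogonality relations below come from this invariance. -/
theorem measurePreserving_dA_mul (α : ℝ) (ω : Circle) :
    MeasurePreserving (fun z : ℂ => (ω : ℂ) * z) (dA α) (dA α) := by
  have h1 : MeasurePreserving (rotation ω) (volume : Measure ℂ) volume :=
    (rotation ω).measurePreserving
  have h2 : MeasurePreserving (rotation ω) (volume.restrict (ball (0 : ℂ) 1))
      (volume.restrict (ball (0 : ℂ) 1)) := by
    have := h1.restrict_preimage (s := ball (0 : ℂ) 1) measurableSet_ball
    rwa [show (rotation ω) ⁻¹' ball (0 : ℂ) 1 = ball 0 1 by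
      ext z; simp only [Set.mem_preimage, mem_ball_zero_iff, LinearIsometryEquiv.norm_map]] at this
  refine ⟨by fun_prop, ?_⟩
  ext s hs
  have hpre : MeasurableSet ((fun z : ℂ => (ω : ℂ) * z) ⁻¹' s) :=
    (by fun_prop : Measurable fun z : ℂ => (ω : ℂ) * z) hs
  rw [Measure.map_apply (by fun_prop) hs, dA, withDensity_apply _ hpre, withDensity_apply _ hs]
  have h3 := h2.setLIntegral_comp_preimage hs (measurable_density α)
  simp only [LinearIsometryEquiv.norm_map] at h3
  exact h3

theorem integral_dA_comp_mul (α : ℝ) (ω : Circle) (F : ℂ → ℂ) :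
    ∫ z, F (ω * z) ∂(dA α) = ∫ z, F z ∂(dA α) :=
  (measurePreserving_dA_mul α ω).integral_comp (Homeomorph.mulLeft₀ (ω : ℂ)
    (Circle.coe_ne_zero ω)).measurableEmbedding F

/-- A function with a nontrivial angular frequency has integral zero. -/
theorem integral_dA_eq_zero (α : ℝ) {F : ℂ → ℂ} {k : ℤ} (hk : k ≠ 0)
    (hF : ∀ (ω : Circle) z, F (ω * z) = (ω : ℂ) ^ k * F z) : ∫ z, F z ∂(dA α) = 0 := by
  -- This rotation satisfies `ω ^ k = -1`, so the integral equals its own opposite.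
  have h1 := integral_dA_comp_mul α (Circle.exp (Real.pi / k)) F
  have h2 : ((Circle.exp (Real.pi / k) : Circle) : ℂ) ^ k = -1 := by
    rw [Circle.coe_exp, ← Complex.exp_int_mul, ← Complex.exp_pi_mul_I]
    congr 1
    have : (k : ℂ) ≠ 0 := by exact_mod_cast hk
    push_cast
    field_simp
  simp_rw [hF, h2, integral_const_mul] at h1
  linear_combination -(1 / 2 : ℂ) * h1

end Measure

/-! ### Harmonic monomials and pointwise bounds on their products. -/

section Monomials

/-- The harmonic monomials: `z ^ k` for `k ≥ 0` and `conj z ^ (-k)` for `k < 0`. -/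
noncomputable def harmonicMonomial (k : ℤ) (z : ℂ) : ℂ := (‖z‖ : ℂ) ^ k.natAbs * (z / ‖z‖) ^ k

theorem harmonicMonomial_natCast (n : ℕ) (z : ℂ) : harmonicMonomial n z = z ^ n := by
  rw [harmonicMonomial, Int.natAbs_natCast, zpow_natCast]
  rcases eq_or_ne z 0 with rfl | hz
  · rcases Nat.eq_zero_or_pos n with rfl | hn
    · simp
    · simp [hn.ne']
  · have : (‖z‖ : ℂ) ≠ 0 := by simpa using hz
    rw [← mul_pow, mul_div_cancel₀ _ this]

theorem harmonicMonomial_neg_natCast (n : ℕ) (z : ℂ) :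
    harmonicMonomial (-n) z = (starRingEnd ℂ z) ^ n := by
  rw [harmonicMonomial, Int.natAbs_neg, Int.natAbs_natCast, zpow_neg, zpow_natCast]
  rcases eq_or_ne z 0 with rfl | hz
  · rcases Nat.eq_zero_or_pos n with rfl | hn
    · simp
    · simp [hn.ne']
  · have h1 : (‖z‖ : ℂ) ≠ 0 := by simpa using hz
    have h2 : starRingEnd ℂ z * z = (‖z‖ : ℂ) ^ 2 := by
      rw [mul_comm, Complex.mul_conj, Complex.normSq_eq_norm_sq]
      push_cast
      rfl
    have h3 : starRingEnd ℂ z = ‖z‖ * (z / ‖z‖)⁻¹ := by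
      field_simp
      exact h2
    rw [h3, mul_pow, inv_pow]

theorem norm_harmonicMonomial (k : ℤ) (z : ℂ) : ‖harmonicMonomial k z‖ = ‖z‖ ^ k.natAbs := by
  obtain ⟨n, rfl | rfl⟩ := k.eq_nat_or_neg
  · simp [harmonicMonomial_natCast]
  · simp [harmonicMonomial_neg_natCast]

theorem harmonicMonomial_circle_mul (k : ℤ) (ω : Circle) (z : ℂ) :
    harmonicMonomial k (ω * z) = (ω : ℂ) ^ k * harmonicMonomial k z := by
  rw [harmonicMonomial, harmonicMonomial, norm_mul, Circle.norm_coe, one_mul, mul_div_assoc, mul_zpow]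
  ring

theorem continuous_harmonicMonomial (k : ℤ) : Continuous (harmonicMonomial k) := by
  obtain ⟨n, rfl | rfl⟩ := k.eq_nat_or_neg
  · rw [funext (harmonicMonomial_natCast n)]
    fun_prop
  · rw [funext (harmonicMonomial_neg_natCast n)]
    fun_prop

theorem harmonicAt_harmonicMonomial (k : ℤ) (z : ℂ) : HarmonicAt (harmonicMonomial k) z := by
  obtain ⟨n, rfl | rfl⟩ := k.eq_nat_or_neg
  · rw [funext (harmonicMonomial_natCast n)]
    exact (analyticAt_id.pow n).harmonicAt
  · have h : harmonicMonomial (-n) = starRingEnd (ℂ → ℂ) (fun z : ℂ => z ^ n) := by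
      ext z
      rw [harmonicMonomial_neg_natCast]
      simp
    rw [h]
    exact (analyticAt_id.pow n).harmonicAt_conj

/-- Both terms have the same angular part. Their radial exponents `|j| + |k|` and `|j + k|` differ
by at most `2 |j|`, so Bernoulli's inequality extracts the factor `|j| (1 - |z|²)`. -/
theorem norm_harmonicMonomial_mul_sub (j k : ℤ) (h : 2 * j.natAbs ≤ k.natAbs) {z : ℂ}
    (hz : z ∈ ball (0 : ℂ) 1) :
    ‖harmonicMonomial j z * harmonicMonomial k z - harmonicMonomial (j + k) z‖ ≤
      j.natAbs * ((1 - ‖z‖ ^ 2) * ‖z‖ ^ (k.natAbs - j.natAbs)) := by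
  have hz1 : ‖z‖ < 1 := by simpa using hz
  have hsq : 0 ≤ 1 - ‖z‖ ^ 2 := by nlinarith [norm_nonneg z]
  have hz0 := norm_nonneg z
  rcases eq_or_ne z 0 with rfl | hne
  · have h1 : ∀ k : ℤ, harmonicMonomial k 0 = if k = 0 then 1 else 0 := by
      intro k
      split_ifs with hk
      · subst hk
        simp [harmonicMonomial]
      · rw [harmonicMonomial, norm_zero, Complex.ofReal_zero, zero_pow (by simpa using hk), zero_mul]
    have h2 : harmonicMonomial j 0 * harmonicMonomial k 0 - harmonicMonomial (j + k) 0 = 0 := by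
      simp only [h1]
      split_ifs <;> first | omega | simp
    rw [h2, norm_zero]
    positivity
  have hu : z / ‖z‖ ≠ 0 := div_ne_zero hne (by simpa using hne)
  have h1 : harmonicMonomial j z * harmonicMonomial k z - harmonicMonomial (j + k) z =
      ((‖z‖ ^ (j.natAbs + k.natAbs) - ‖z‖ ^ (j + k).natAbs : ℝ) : ℂ) * (z / ‖z‖) ^ (j + k) := by
    simp only [harmonicMonomial]
    rw [zpow_add₀ hu]
    push_cast
    ring
  have h2 : ‖(z / ‖z‖) ^ (j + k)‖ = 1 := by
    rw [norm_zpow, norm_div, Complex.norm_real, norm_norm, div_self (by simpa using hne), one_zpow]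
  rw [h1, norm_mul, h2, mul_one, Complex.norm_real, Real.norm_eq_abs, abs_sub_comm]
  have h3 : ‖z‖ ^ (j.natAbs + k.natAbs) ≤ ‖z‖ ^ (j + k).natAbs :=
    pow_le_pow_of_le_one hz0 hz1.le (by omega)
  have h4 : ‖z‖ ^ (j + k).natAbs ≤ ‖z‖ ^ (k.natAbs - j.natAbs) :=
    pow_le_pow_of_le_one hz0 hz1.le (by omega)
  have h5 : ‖z‖ ^ (j + k).natAbs * (‖z‖ ^ 2) ^ j.natAbs ≤ ‖z‖ ^ (j.natAbs + k.natAbs) := by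
    rw [← pow_mul, ← pow_add]
    exact pow_le_pow_of_le_one hz0 hz1.le (by omega)
  have h6 : 1 - (‖z‖ ^ 2) ^ j.natAbs ≤ j.natAbs * (1 - ‖z‖ ^ 2) := by
    have := one_add_mul_le_pow (a := ‖z‖ ^ 2 - 1) (by nlinarith) j.natAbs
    rw [add_sub_cancel] at this
    linarith
  rw [abs_of_nonneg (by linarith)]
  calc _ ≤ ‖z‖ ^ (j + k).natAbs * (1 - (‖z‖ ^ 2) ^ j.natAbs) := by linarith
    _ ≤ ‖z‖ ^ (j + k).natAbs * (j.natAbs * (1 - ‖z‖ ^ 2)) := by gcongr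
    _ ≤ ‖z‖ ^ (k.natAbs - j.natAbs) * (j.natAbs * (1 - ‖z‖ ^ 2)) := by gcongr
    _ = _ := by ring

/-- The inequality `-log t ≤ 1 / t - 1` at `t = |z|²` gives `-log |z| * |z|² ≤ 1 - |z|²`. Two powers
of `|z|` are thus traded for the weight `1 - |z|²`. -/
theorem norm_log_mul_harmonicMonomial_le (k : ℤ) (h : 4 ≤ k.natAbs) {z : ℂ}
    (hz : z ∈ ball (0 : ℂ) 1) :
    ‖(Real.log ‖z‖ : ℂ) * harmonicMonomial k z‖ ≤
      1 * ((1 - ‖z‖ ^ 2) * ‖z‖ ^ (k.natAbs - 2)) := by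
  have hz1 : ‖z‖ < 1 := by simpa using hz
  have hsq : 0 ≤ 1 - ‖z‖ ^ 2 := by nlinarith [norm_nonneg z]
  rcases eq_or_ne z 0 with rfl | hne
  · simp
  have hz0 : 0 < ‖z‖ := norm_pos_iff.2 hne
  rw [norm_mul, norm_harmonicMonomial, Complex.norm_real, Real.norm_eq_abs,
    abs_of_nonpos (Real.log_nonpos hz0.le hz1.le)]
  have h1 : -Real.log ‖z‖ * ‖z‖ ^ 2 ≤ 1 - ‖z‖ ^ 2 := by
    have h2 := Real.add_one_le_exp (-Real.log (‖z‖ ^ 2))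
    rw [Real.exp_neg, Real.exp_log (by positivity), Real.log_pow] at h2
    have h3 : (‖z‖ ^ 2)⁻¹ * ‖z‖ ^ 2 = 1 := inv_mul_cancel₀ (by positivity)
    have h4 := mul_le_mul_of_nonneg_right h2 (sq_nonneg ‖z‖)
    rw [h3] at h4
    push_cast at h4
    have h5 : 0 ≤ -Real.log ‖z‖ * ‖z‖ ^ 2 :=
      mul_nonneg (neg_nonneg.2 (Real.log_nonpos hz0.le hz1.le)) (sq_nonneg _)
    linarith
  have h2 : ‖z‖ ^ k.natAbs = ‖z‖ ^ 2 * ‖z‖ ^ (k.natAbs - 2) := by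
    rw [← pow_add]
    congr 1
    omega
  rw [h2, ← mul_assoc, one_mul]
  gcongr

end Monomials

/-! ### Expansion of harmonic functions in harmonic monomials. -/

section Expansion

/-- Write `v = (F + conj F) / 2` with `F` holomorphic. The Taylor series of `F` supplies the
nonnegative indices and its conjugate the negative ones. -/
theorem exists_hasSum_harmonicMonomial_of_real {v : ℂ → ℝ} {R : ℝ} (hv : HarmonicOnNhd v (ball 0 R)) :
    ∃ b : ℤ → ℂ, ∀ z ∈ ball (0 : ℂ) R, HasSum (fun k => b k * harmonicMonomial k z) (v z : ℂ) := by
  obtain ⟨F, hF, hre⟩ := hv.exists_analyticOnNhd_ball_re_eq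
  set a : ℕ → ℂ := fun n => (n.factorial : ℂ)⁻¹ * iteratedDeriv n F 0 with ha
  have h1 : ∀ z ∈ ball (0 : ℂ) R, HasSum (fun n => a n * z ^ n) (F z) := by
    intro z hz
    have := Complex.hasSum_taylorSeries_on_ball hF.differentiableOn hz
    simpa [ha, mul_comm, mul_left_comm, mul_assoc] using this
  -- The constant term of `conj F` goes to index `0`, so the conjugate series contributes from index
  -- `-1` downwards.
  refine ⟨fun k => if 0 ≤ k then a k.natAbs / 2 + (if k.natAbs = 0 then starRingEnd ℂ (a 0) / 2 else 0)
    else starRingEnd ℂ (a k.natAbs) / 2, fun z hz => ?_⟩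
  have h2 := h1 z hz
  have h3 : HasSum (fun n => starRingEnd ℂ (a n) * starRingEnd ℂ z ^ n) (starRingEnd ℂ (F z)) := by
    have := Complex.hasSum_conj'.2 h2
    simpa using this
  have h4 := (hasSum_nat_add_iff' 1).2 h3
  simp only [Finset.range_one, Finset.sum_singleton, pow_zero, mul_one] at h4
  have h5 := (h2.div_const 2).add (hasSum_ite_eq 0 (starRingEnd ℂ (a 0) / 2))
  have h6 := HasSum.of_nat_of_neg_add_one (f := fun k : ℤ => (if 0 ≤ k then a k.natAbs / 2 +
    (if k.natAbs = 0 then starRingEnd ℂ (a 0) / 2 else 0)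
    else starRingEnd ℂ (a k.natAbs) / 2) * harmonicMonomial k z)
    (m := F z / 2 + starRingEnd ℂ (a 0) / 2) (m' := (starRingEnd ℂ (F z) - starRingEnd ℂ (a 0)) / 2)
    (by
      refine h5.congr_fun fun n => ?_
      rw [harmonicMonomial_natCast]
      simp only [Nat.cast_nonneg, if_true, Int.natAbs_natCast]
      split_ifs with hn
      · subst hn
        simp
      · ring)
    (by
      refine (h4.div_const 2).congr_fun fun n => ?_
      have e1 : (-((n : ℤ) + 1)) = -((n + 1 : ℕ) : ℤ) := by push_cast; ring
      rw [e1, harmonicMonomial_neg_natCast]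
      have e2 : ¬ (0 : ℤ) ≤ -((n + 1 : ℕ) : ℤ) := by omega
      rw [if_neg e2, Int.natAbs_neg, Int.natAbs_natCast]
      ring)
  convert h6 using 1
  rw [← hre hz]
  have := Complex.add_conj (F z)
  push_cast at this
  linear_combination (-1 / 2 : ℂ) * this

/-- Expansion of a harmonic function on a disk in harmonic monomials. -/
theorem exists_hasSum_harmonicMonomial {f : ℂ → ℂ} {R : ℝ} (hf : HarmonicOnNhd f (ball 0 R)) :
    ∃ b : ℤ → ℂ, ∀ z ∈ ball (0 : ℂ) R, HasSum (fun k => b k * harmonicMonomial k z) (f z) := by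
  obtain ⟨b, hb⟩ := exists_hasSum_harmonicMonomial_of_real (hf.comp_CLM Complex.reCLM)
  obtain ⟨c, hc⟩ := exists_hasSum_harmonicMonomial_of_real (hf.comp_CLM Complex.imCLM)
  refine ⟨fun k => b k + c k * Complex.I, fun z hz => ?_⟩
  have := (hb z hz).add ((hc z hz).mul_right Complex.I)
  simp only [Function.comp_apply, Complex.reCLM_apply, Complex.imCLM_apply, Complex.re_add_im] at this
  refine this.congr_fun fun k => ?_
  ring

/-- Evaluate at the point `r` of the real axis: unconditional summability of complex numbers is
absolute. -/
theorem summable_norm_mul_pow {f : ℂ → ℂ} {b : ℤ → ℂ} {R : ℝ}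
    (hb : ∀ z ∈ ball (0 : ℂ) R, HasSum (fun k => b k * harmonicMonomial k z) (f z)) {r : ℝ}
    (hr : 0 ≤ r) (hrR : r < R) : Summable fun k => ‖b k‖ * r ^ k.natAbs := by
  have := (hb r (by simpa [abs_of_nonneg hr] using hrR)).summable.norm
  simpa [norm_harmonicMonomial, abs_of_nonneg hr] using this

/-- The powers of the intermediate radius `(1 + R) / 2 > 1` dominate linear growth. The weight `|k|
+ 1` is the loss incurred later when multiplying by the `k`-th monomial. -/
theorem summable_norm_mul_natAbs {f : ℂ → ℂ} {b : ℤ → ℂ} {R : ℝ} (hR : 1 < R)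
    (hb : ∀ z ∈ ball (0 : ℂ) R, HasSum (fun k => b k * harmonicMonomial k z) (f z)) :
    Summable fun k => ‖b k‖ * (k.natAbs + 1) := by
  have h1 := summable_norm_mul_pow hb (r := (1 + R) / 2) (by linarith) (by linarith)
  obtain ⟨K, hK⟩ : ∃ K : ℝ, ∀ n : ℕ, (n : ℝ) + 1 ≤ K * ((1 + R) / 2) ^ n := by
    refine ⟨1 + 2 / (R - 1), fun n => ?_⟩
    have h2 := one_add_mul_le_pow (a := (R - 1) / 2) (by linarith) n
    rw [show 1 + (R - 1) / 2 = (1 + R) / 2 by ring] at h2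
    have h3 : (0 : ℝ) ≤ n := n.cast_nonneg
    have h4 : 0 < R - 1 := by linarith
    calc (n : ℝ) + 1 ≤ (1 + 2 / (R - 1)) * (1 + n * ((R - 1) / 2)) := by
          have : (1 + 2 / (R - 1)) * (1 + n * ((R - 1) / 2)) =
            n + 1 + n * ((R - 1) / 2) + 2 / (R - 1) := by
              field_simp
              ring
          rw [this]
          have : 0 ≤ n * ((R - 1) / 2) + 2 / (R - 1) := by positivity
          linarith
      _ ≤ _ := by gcongr
  refine (h1.mul_left K).of_nonneg_of_le (fun k => by positivity) fun k => ?_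
  calc _ ≤ ‖b k‖ * (K * ((1 + R) / 2) ^ k.natAbs) := by
        gcongr
        exact hK _
    _ = _ := by ring

end Expansion

/-! ### The Hilbert basis of harmonic monomials. -/

section L2

variable {α : ℝ}

theorem norm_toLp_sq {F : ℂ → ℂ} (hF : MemLp F 2 (dA α)) :
    ‖hF.toLp F‖ ^ 2 = ∫ z, ‖F z‖ ^ 2 ∂(dA α) := by
  have h1 := L2.inner_def (𝕜 := ℂ) (hF.toLp F) (hF.toLp F)
  rw [inner_self_eq_norm_sq_to_K] at h1
  have h2 : (∫ z, inner ℂ (hF.toLp F z) (hF.toLp F z) ∂(dA α)) = ((∫ z, ‖F z‖ ^ 2 ∂(dA α) : ℝ) : ℂ) := by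
    rw [← integral_complex_ofReal]
    refine integral_congr_ae ?_
    filter_upwards [hF.coeFn_toLp] with z hz
    rw [hz, inner_self_eq_norm_sq_to_K]
    push_cast
    rfl
  rw [h2] at h1
  exact Complex.ofReal_injective (by rw [← h1]; push_cast; rfl)

/-- Functions of different angular frequencies are orthogonal. -/
theorem inner_eq_zero_of_circle_mul {f g : L2 α} {F G : ℂ → ℂ} (hf : f =ᵐ[dA α] F)
    (hg : g =ᵐ[dA α] G) {k l : ℤ} (hkl : k ≠ l)
    (hFk : ∀ (ω : Circle) z, F (ω * z) = (ω : ℂ) ^ k * F z)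
    (hGl : ∀ (ω : Circle) z, G (ω * z) = (ω : ℂ) ^ l * G z) : inner ℂ f g = 0 := by
  rw [L2.inner_def]
  have h1 : ∫ z, inner ℂ (f z) (g z) ∂(dA α) = ∫ z, G z * starRingEnd ℂ (F z) ∂(dA α) := by
    refine integral_congr_ae ?_
    filter_upwards [hf, hg] with z h1 h2
    rw [h1, h2, RCLike.inner_apply]
  rw [h1]
  refine integral_dA_eq_zero α (sub_ne_zero.2 hkl.symm) fun ω z => ?_
  rw [hFk, hGl, map_mul, zpow_sub₀ (Circle.coe_ne_zero ω), map_zpow₀, ← Circle.coe_inv_eq_conj,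
    Circle.coe_inv, inv_zpow]
  ring

theorem memLp_of_bound (hα : -1 < α) {F : ℂ → ℂ}
    (hF : AEStronglyMeasurable F (dA α)) {K : ℝ} (hK : ∀ z ∈ ball (0 : ℂ) 1, ‖F z‖ ≤ K) :
    MemLp F 2 (dA α) := by
  have := isFiniteMeasure_dA hα
  exact MemLp.of_bound hF K ((ae_dA_mem_ball α).mono hK)

theorem memLp_harmonicMonomial (hα : -1 < α) (k : ℤ) : MemLp (harmonicMonomial k) 2 (dA α) := by
  refine memLp_of_bound hα (continuous_harmonicMonomial k).aestronglyMeasurable (K := 1) fun z hz => ?_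
  rw [norm_harmonicMonomial]
  exact pow_le_one₀ (norm_nonneg _) (mem_ball_zero_iff.1 hz).le

/-- The harmonic monomials as elements of `L²(𝔻, dA_α)`. -/
noncomputable def monomialLp (hα : -1 < α) (k : ℤ) : L2 α :=
  (memLp_harmonicMonomial hα k).toLp (harmonicMonomial k)

theorem coeFn_monomialLp (hα : -1 < α) (k : ℤ) : monomialLp hα k =ᵐ[dA α] harmonicMonomial k :=
  MemLp.coeFn_toLp _

theorem monomialLp_mem (hα : -1 < α) (k : ℤ) : monomialLp hα k ∈ harmonicSubspace α :=
  ⟨harmonicMonomial k, fun z _ => harmonicAt_harmonicMonomial k z, coeFn_monomialLp hα k⟩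

theorem norm_monomialLp_sq (hα : -1 < α) (k : ℤ) :
    ‖monomialLp hα k‖ ^ 2 = 2 * (α + 1) * radialMoment α k.natAbs := by
  rw [monomialLp, norm_toLp_sq, ← integral_dA_norm_pow hα]
  refine integral_congr_ae (ae_of_all _ fun z => ?_)
  simp only [norm_harmonicMonomial]
  rw [← pow_mul, mul_comm 2]

theorem norm_monomialLp_pos (hα : -1 < α) (k : ℤ) : 0 < ‖monomialLp hα k‖ := by
  refine (sq_pos_iff.1 ?_).lt_of_le' (norm_nonneg _)
  rw [norm_monomialLp_sq]
  have := radialMoment_pos hα k.natAbs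
  have h1 : 0 < α + 1 := by linarith
  positivity

theorem inner_monomialLp_of_ne (hα : -1 < α) {k l : ℤ} (h : k ≠ l) :
    inner ℂ (monomialLp hα k) (monomialLp hα l) = 0 :=
  inner_eq_zero_of_circle_mul (coeFn_monomialLp hα k) (coeFn_monomialLp hα l) h
    (harmonicMonomial_circle_mul k) (harmonicMonomial_circle_mul l)

/-- On a smaller ball the expansion is dominated by a summable series and may be integrated
termwise. The ball is rotation invariant, so only the term of frequency `k` survives. -/
theorem setIntegral_ball_conj_mul (hα : -1 < α) {f : ℂ → ℂ} {b : ℤ → ℂ}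
    (hb : ∀ z ∈ ball (0 : ℂ) 1, HasSum (fun k => b k * harmonicMonomial k z) (f z)) {r : ℝ}
    (hr : 0 ≤ r) (hr1 : r < 1) (k : ℤ) :
    ∫ z in ball 0 r, starRingEnd ℂ (harmonicMonomial k z) * f z ∂(dA α) =
      b k * ∫ z in ball 0 r, starRingEnd ℂ (harmonicMonomial k z) * harmonicMonomial k z ∂(dA α) := by
  have := isFiniteMeasure_dA hα
  set F : ℤ → ℂ → ℂ := fun j z =>
    starRingEnd ℂ (harmonicMonomial k z) * (b j * harmonicMonomial j z) with hF
  have hcont : ∀ j, Continuous (F j) := fun j =>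
    (Complex.continuous_conj.comp (continuous_harmonicMonomial k)).mul
      (continuous_const.mul (continuous_harmonicMonomial j))
  have hbound : ∀ j, ∀ z ∈ ball (0 : ℂ) r, ‖F j z‖ ≤ ‖b j‖ * r ^ j.natAbs := by
    intro j z hz
    have h1 : ‖z‖ < r := by simpa using hz
    rw [hF, norm_mul, norm_mul, RCLike.norm_conj, norm_harmonicMonomial, norm_harmonicMonomial]
    calc _ ≤ 1 * (‖b j‖ * ‖z‖ ^ j.natAbs) := by
          gcongr
          exact pow_le_one₀ (norm_nonneg _) (by linarith)
      _ ≤ _ := by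
        rw [one_mul]
        gcongr
  have hint : ∀ j, Integrable (F j) ((dA α).restrict (ball 0 r)) := fun j =>
    Integrable.of_bound (hcont j).aestronglyMeasurable _
      ((ae_restrict_iff' measurableSet_ball).2 (ae_of_all _ (hbound j)))
  have hsum : Summable fun j => ∫ z in ball 0 r, ‖F j z‖ ∂(dA α) := by
    refine ((summable_norm_mul_pow hb hr hr1).mul_right ((dA α).real (ball 0 r))).of_nonneg_of_le
      (fun j => integral_nonneg fun z => norm_nonneg _) fun j => ?_
    have := norm_setIntegral_le_of_norm_le_const (μ := dA α) (s := ball (0 : ℂ) r)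
      (f := fun z => ‖F j z‖) (measure_lt_top _ _) (C := ‖b j‖ * r ^ j.natAbs) (fun z hz => by
        rw [norm_norm]
        exact hbound j z hz)
    rwa [Real.norm_of_nonneg (integral_nonneg fun z => norm_nonneg _)] at this
  have h1 := hasSum_integral_of_summable_integral_norm hint hsum
  have h2 : ∫ z in ball 0 r, ∑' j, F j z ∂(dA α) =
      ∫ z in ball 0 r, starRingEnd ℂ (harmonicMonomial k z) * f z ∂(dA α) := by
    refine setIntegral_congr_fun measurableSet_ball fun z hz => ?_
    exact ((hb z (ball_subset_ball hr1.le hz)).mul_left _).tsum_eq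
  have h3 : ∀ j, j ≠ k → ∫ z in ball 0 r, F j z ∂(dA α) = 0 := by
    intro j hj
    rw [← integral_indicator measurableSet_ball]
    refine integral_dA_eq_zero α (sub_ne_zero.2 hj) fun ω z => ?_
    by_cases hz : z ∈ ball (0 : ℂ) r
    · have hz' : (ω : ℂ) * z ∈ ball (0 : ℂ) r := by simpa [Circle.norm_coe] using hz
      rw [Set.indicator_of_mem hz, Set.indicator_of_mem hz']
      simp only [hF]
      rw [harmonicMonomial_circle_mul, harmonicMonomial_circle_mul, map_mul,
        zpow_sub₀ (Circle.coe_ne_zero ω), map_zpow₀, ← Circle.coe_inv_eq_conj,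
        Circle.coe_inv, inv_zpow]
      ring
    · have hz' : (ω : ℂ) * z ∉ ball (0 : ℂ) r := by simpa [Circle.norm_coe] using hz
      rw [Set.indicator_of_notMem hz, Set.indicator_of_notMem hz', mul_zero]
  rw [h2] at h1
  rw [h1.unique (hasSum_single k h3), ← integral_const_mul]
  refine integral_congr_ae (ae_of_all _ fun z => ?_)
  simp only [hF]
  ring

/-- The harmonic monomials span a dense subspace of `ℋ²_α(𝔻)`. -/
theorem eq_zero_of_inner_monomialLp_eq_zero (hα : -1 < α) {x : L2 α} (hx : x ∈ harmonicSubspace α)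
    (h : ∀ k, inner ℂ (monomialLp hα k) x = 0) : x = 0 := by
  have := isFiniteMeasure_dA hα
  obtain ⟨f, hf, hxf⟩ := hx
  obtain ⟨b, hb⟩ := exists_hasSum_harmonicMonomial hf
  have hU : ⋃ n : ℕ, ball (0 : ℂ) (1 - 1 / ((n : ℝ) + 1)) = ball 0 1 := by
    ext z
    simp only [Set.mem_iUnion, mem_ball_zero_iff]
    constructor
    · rintro ⟨n, hn⟩
      have : 0 < 1 / ((n : ℝ) + 1) := by positivity
      linarith
    · intro hz
      obtain ⟨n, hn⟩ := exists_nat_one_div_lt (sub_pos.2 hz)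
      exact ⟨n, by linarith⟩
  have hmono : Monotone fun n : ℕ => ball (0 : ℂ) (1 - 1 / ((n : ℝ) + 1)) := by
    intro m n hmn
    refine ball_subset_ball ?_
    have := Nat.one_div_le_one_div (α := ℝ) hmn
    linarith
  have hlim : ∀ G : ℂ → ℂ, Integrable G (dA α) → Tendsto (fun n : ℕ =>
      ∫ z in ball 0 (1 - 1 / ((n : ℝ) + 1)), G z ∂(dA α)) atTop (𝓝 (∫ z, G z ∂(dA α))) := by
    intro G hG
    have h1 := tendsto_setIntegral_of_monotone (μ := dA α) (f := G)
      (fun n : ℕ => measurableSet_ball) hmono hG.integrableOn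
    rw [hU, setIntegral_eq_integral_of_ae_compl_eq_zero] at h1
    · exact h1
    · filter_upwards [ae_dA_mem_ball α] with z hz hz'
      exact absurd hz hz'
  have hfL : MemLp f 2 (dA α) := (memLp_congr_ae hxf).1 (Lp.memLp x)
  -- Letting the smaller balls exhaust the disk expresses the inner product with the `k`-th monomial
  -- as `b k` times the nonzero squared norm of that monomial.
  have hb0 : ∀ k, b k = 0 := by
    intro k
    have hmon := memLp_harmonicMonomial hα k
    have hconj : MemLp (fun z => starRingEnd ℂ (harmonicMonomial k z)) 2 (dA α) := hmon.star
    have i1 : Integrable (fun z => starRingEnd ℂ (harmonicMonomial k z) * f z) (dA α) :=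
      hconj.integrable_mul hfL
    have i2 : Integrable (fun z => starRingEnd ℂ (harmonicMonomial k z) * harmonicMonomial k z)
      (dA α) := hconj.integrable_mul hmon
    have l1 := hlim _ i1
    have l2 := (hlim _ i2).const_mul (b k)
    have e1 := fun n : ℕ => setIntegral_ball_conj_mul (α := α) hα hb
      (r := 1 - 1 / ((n : ℝ) + 1)) (by
        rw [sub_nonneg, div_le_one (by positivity)]
        have : (0 : ℝ) ≤ n := n.cast_nonneg
        linarith) (by
        have : 0 < 1 / ((n : ℝ) + 1) := by positivity
        linarith) k
    simp_rw [e1] at l1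
    have e2 := tendsto_nhds_unique l1 l2
    have e3 : ∫ z, starRingEnd ℂ (harmonicMonomial k z) * f z ∂(dA α) = 0 := by
      rw [← h k, L2.inner_def]
      refine integral_congr_ae ?_
      filter_upwards [hxf, coeFn_monomialLp hα k] with z h1 h2
      rw [h1, h2, RCLike.inner_apply, mul_comm]
    have e4 : ∫ z, starRingEnd ℂ (harmonicMonomial k z) * harmonicMonomial k z ∂(dA α) =
        inner ℂ (monomialLp hα k) (monomialLp hα k) := by
      rw [L2.inner_def]
      refine integral_congr_ae ?_
      filter_upwards [coeFn_monomialLp hα k] with z h2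
      rw [h2, RCLike.inner_apply, mul_comm]
    rw [e3, e4] at e2
    refine (mul_eq_zero.1 e2.symm).resolve_right ?_
    rw [inner_self_eq_zero]
    exact norm_pos_iff.1 (norm_monomialLp_pos hα k)
  refine Lp.ext ?_
  filter_upwards [hxf, ae_dA_mem_ball α, Lp.coeFn_zero ℂ 2 (dA α)] with z h1 h2 h3
  rw [h1, h3]
  refine (hb z h2).unique ?_
  simp [hb0, hasSum_zero]

theorem orthonormal_monomialLp (hα : -1 < α) : Orthonormal ℂ (fun k =>
    (⟨(‖monomialLp hα k‖ : ℂ)⁻¹ • monomialLp hα k,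
      (harmonicSubspace α).smul_mem _ (monomialLp_mem hα k)⟩ : harmonicSubspace α)) := by
  constructor
  · intro k
    rw [Submodule.coe_norm, norm_smul, norm_inv, Complex.norm_real, norm_norm,
      inv_mul_cancel₀ (norm_monomialLp_pos hα k).ne']
  · intro k l hkl
    rw [Submodule.coe_inner, inner_smul_left, inner_smul_right, inner_monomialLp_of_ne hα hkl]
    simp

/-- The normalised harmonic monomials form a Hilbert basis of `ℋ²_α(𝔻)`. -/
theorem exists_hilbertBasis (hα : -1 < α) : ∃ e : HilbertBasis ℤ ℂ (harmonicSubspace α),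
    ∀ k, (e k : L2 α) = (‖monomialLp hα k‖ : ℂ)⁻¹ • monomialLp hα k := by
  have : CompleteSpace (harmonicSubspace α) := (isClosed_harmonicSubspace α).completeSpace_coe
  refine ⟨HilbertBasis.mkOfOrthogonalEqBot (orthonormal_monomialLp hα) ?_, fun k => by
    rw [HilbertBasis.coe_mkOfOrthogonalEqBot]⟩
  rw [Submodule.eq_bot_iff]
  intro x hx
  refine Subtype.ext (eq_zero_of_inner_monomialLp_eq_zero hα x.2 fun k => ?_)
  have h1 := (Submodule.mem_orthogonal _ _).1 hx _ (Submodule.subset_span ⟨k, rfl⟩)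
  rw [Submodule.coe_inner, inner_smul_left] at h1
  refine (mul_eq_zero.1 h1).resolve_left ?_
  simpa using norm_pos_iff.1 (norm_monomialLp_pos hα k)

end L2

/-! ### Bôcher's theorem at a puncture. -/

/-- Locally `v` is the real part of a holomorphic function, and holomorphy survives composition. -/
theorem _root_.InnerProductSpace.HarmonicAt.comp_analyticAt {v : ℂ → ℝ} {g : ℂ → ℂ} {z : ℂ}
    (hv : HarmonicAt v (g z)) (hg : AnalyticAt ℂ g z) : HarmonicAt (fun w => v (g w)) z := by
  obtain ⟨ε, hε, hball⟩ := Metric.eventually_nhds_iff_ball.1 hv.eventually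
  obtain ⟨F, hF, hre⟩ := HarmonicOnNhd.exists_analyticOnNhd_ball_re_eq (f := v) hball
  have hFg : AnalyticAt ℂ (fun w => F (g w)) z := (hF _ (mem_ball_self hε)).comp hg
  refine (harmonicAt_congr_nhds ?_).2 hFg.harmonicAt_re
  filter_upwards [hg.continuousAt.preimage_mem_nhds (ball_mem_nhds _ hε)] with w hw
  exact (hre hw).symm

/-- A harmonic function on the punctured unit disk, pulled back to the upper half-plane along
`w ↦ exp (2 π i w)`, is the real part of a holomorphic function. -/
theorem exists_differentiable_re_eq_comp_qParam {v : ℂ → ℝ}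
    (hv : HarmonicOnNhd v (ball 0 1 \ {0})) : ∃ Φ : ℂ → ℂ,
      (∀ w : ℂ, 0 < w.im → AnalyticAt ℂ Φ w) ∧
      ∀ w : ℂ, 0 < w.im → (Φ w).re = v (Function.Periodic.qParam 1 w) := by
  -- The Cayley transform carries the unit disk to the upper half-plane, so the pullback lives on a
  -- ball, where harmonic functions are known to be real parts.
  set C : ℂ → ℂ := fun ζ => Complex.I * ((1 + ζ) / (1 - ζ)) with hC
  have hCim : ∀ ζ ∈ ball (0 : ℂ) 1, 0 < (C ζ).im := by
    intro ζ hζ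
    have h1 : ‖ζ‖ < 1 := by simpa using hζ
    have h2 : ζ.re * ζ.re + ζ.im * ζ.im < 1 := by
      rw [← Complex.normSq_apply, Complex.normSq_eq_norm_sq]
      nlinarith [norm_nonneg ζ]
    have h3 : 0 < Complex.normSq (1 - ζ) := by
      rw [Complex.normSq_pos, sub_ne_zero]
      rintro rfl
      simp at h1
    simp only [hC, Complex.I_mul_im, Complex.div_re, Complex.add_re, Complex.sub_re,
      Complex.add_im, Complex.sub_im, Complex.one_re, Complex.one_im]
    rw [← add_div]
    refine div_pos ?_ h3
    nlinarith
  have hCan : ∀ ζ ∈ ball (0 : ℂ) 1, AnalyticAt ℂ C ζ := by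
    intro ζ hζ
    have h3 : 1 - ζ ≠ 0 := by
      rw [sub_ne_zero]
      rintro rfl
      simp at hζ
    exact analyticAt_const.mul ((analyticAt_const.add analyticAt_id).div
      (analyticAt_const.sub analyticAt_id) h3)
  have hq : ∀ w, AnalyticAt ℂ (Function.Periodic.qParam 1) w := fun w =>
    Function.Periodic.differentiable_qParam.analyticAt w
  have hmem : ∀ w : ℂ, 0 < w.im → Function.Periodic.qParam 1 w ∈ ball (0 : ℂ) 1 \ {0} := by
    intro w hw
    refine ⟨?_, Function.Periodic.qParam_ne_zero w⟩
    rw [mem_ball_zero_iff]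
    exact Function.Periodic.norm_qParam_lt_one one_pos hw
  have hU : HarmonicOnNhd (fun ζ => v (Function.Periodic.qParam 1 (C ζ))) (ball 0 1) := by
    intro ζ hζ
    exact HarmonicAt.comp_analyticAt (g := fun ζ => Function.Periodic.qParam 1 (C ζ))
      (hv _ (hmem _ (hCim ζ hζ))) ((hq (C ζ)).fun_comp (hCan ζ hζ))
  obtain ⟨F, hF, hre⟩ := hU.exists_analyticOnNhd_ball_re_eq
  have hinv : ∀ w : ℂ, 0 < w.im → (w - Complex.I) / (w + Complex.I) ∈ ball (0 : ℂ) 1 := by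
    intro w hw
    have h0 : 0 < ‖w + Complex.I‖ := by
      rw [norm_pos_iff]
      intro h
      have := congrArg Complex.im h
      simp at this
      linarith
    rw [mem_ball_zero_iff, norm_div, div_lt_one h0]
    refine lt_of_pow_lt_pow_left₀ 2 (norm_nonneg _) ?_
    rw [← Complex.normSq_eq_norm_sq, ← Complex.normSq_eq_norm_sq, Complex.normSq_apply,
      Complex.normSq_apply]
    simp
    nlinarith
  have hne : ∀ w : ℂ, 0 < w.im → w + Complex.I ≠ 0 := by
    intro w hw h
    have := congrArg Complex.im h
    simp at this
    linarith
  refine ⟨fun w => F ((w - Complex.I) / (w + Complex.I)), fun w hw => ?_, fun w hw => ?_⟩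
  · refine AnalyticAt.fun_comp (hF _ (hinv w hw)) ?_
    exact (analyticAt_id.sub analyticAt_const).div (analyticAt_id.add analyticAt_const) (hne w hw)
  · refine (hre (hinv w hw)).trans ?_
    have : C ((w - Complex.I) / (w + Complex.I)) = w := by
      have h1 := hne w hw
      have h2 : 1 - (w - Complex.I) / (w + Complex.I) = 2 * Complex.I / (w + Complex.I) := by
        field_simp
        ring
      have h3 : 1 + (w - Complex.I) / (w + Complex.I) = 2 * w / (w + Complex.I) := by
        field_simp
        ring
      simp only [hC]
      rw [h2, h3]
      field_simp
    simp only [this]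

/-- A holomorphic function on the upper half-plane with vanishing real part is constant. -/
theorem exists_const_of_re_eq_zero {D : ℂ → ℂ} (hD : ∀ w : ℂ, 0 < w.im → AnalyticAt ℂ D w)
    (h0 : ∀ w : ℂ, 0 < w.im → (D w).re = 0) :
    ∃ t : ℝ, ∀ w : ℂ, 0 < w.im → D w = t * Complex.I := by
  have hconv : Convex ℝ {w : ℂ | 0 < w.im} := convex_halfSpace_im_gt 0
  have hopen : IsOpen {w : ℂ | 0 < w.im} := isOpen_lt continuous_const Complex.continuous_im
  have key : ∃ d : ℂ, ∀ w ∈ {w : ℂ | 0 < w.im}, D w = d := by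
    rcases AnalyticOnNhd.is_constant_or_isOpen (U := {w : ℂ | 0 < w.im}) hD hconv.isPreconnected
      with h | h
    · exact h
    · exfalso
      have h1 := h _ subset_rfl hopen
      have h2 : D Complex.I ∈ D '' {w : ℂ | 0 < w.im} := ⟨Complex.I, by simp, rfl⟩
      obtain ⟨ε, hε, hb⟩ := Metric.isOpen_iff.1 h1 _ h2
      -- An open image would contain a value with positive real part.
      obtain ⟨w, hw, hwe⟩ := hb (show D Complex.I + (ε / 2 : ℝ) ∈ ball (D Complex.I) ε by
        rw [mem_ball, dist_self_add_left, Complex.norm_real, Real.norm_of_nonneg (by positivity)]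
        linarith)
      have h3 := congrArg Complex.re hwe
      rw [h0 w hw, Complex.add_re, h0 Complex.I (by simp), Complex.ofReal_re] at h3
      linarith
  obtain ⟨d, hd⟩ := key
  refine ⟨d.im, fun w hw => ?_⟩
  have h1 : d.re = 0 := by rw [← hd w hw]; exact h0 w hw
  rw [hd w hw]
  apply Complex.ext <;> simp [h1]

/-- **Bôcher's theorem** at a puncture: near `0`, a harmonic function on the punctured disk that is
bounded above is the sum of a multiple of `log |z|` and the logarithm of the modulus of a
nonvanishing holomorphic function. -/
theorem exists_eventually_eq_log_add_log_norm {v : ℂ → ℝ}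
    (hv : HarmonicOnNhd v (ball 0 1 \ {0})) {M : ℝ} (hM : ∀ᶠ z in 𝓝[≠] (0 : ℂ), v z ≤ M) :
    ∃ (c : ℝ) (g : ℂ → ℂ), AnalyticAt ℂ g 0 ∧ g 0 ≠ 0 ∧
      ∀ᶠ z in 𝓝[≠] (0 : ℂ), v z = c * Real.log ‖z‖ + Real.log ‖g z‖ := by
  classical
  obtain ⟨Φ, hΦ, hre⟩ := exists_differentiable_re_eq_comp_qParam hv
  have hq1 : ∀ w : ℂ, Function.Periodic.qParam 1 (w + 1) = Function.Periodic.qParam 1 w := by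
    intro w
    simp only [Function.Periodic.qParam, Complex.ofReal_one, div_one, mul_add, mul_one]
    rw [Complex.exp_add, Complex.exp_two_pi_mul_I, mul_one]
  obtain ⟨t, ht⟩ := exists_const_of_re_eq_zero (D := fun w => Φ (w + 1) - Φ w)
    (fun w hw => (AnalyticAt.fun_comp (f := fun w => w + 1) (hΦ (w + 1) (by simpa using hw))
      (analyticAt_id.add analyticAt_const)).sub (hΦ w hw))
    (fun w hw => by
      rw [Complex.sub_re, hre w hw, hre (w + 1) (by simpa using hw), hq1, sub_self])
  -- The monodromy of `Φ` under `w ↦ w + 1` is `t i`. Subtracting `t i w` in the exponent makes the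
  -- exponential periodic, and the periodic factor `exp (2 π i k w)`, with `k ≥ t`, keeps it bounded
  -- as `Im w → ∞`, since then `t ≤ 2 π k`.
  obtain ⟨k, hk⟩ := exists_nat_ge t
  set E : ℂ → ℂ := fun w => if 0 < w.im then
    Complex.exp (Φ w - t * Complex.I * w + 2 * Real.pi * Complex.I * k * w) else 0 with hE
  have hEper : Function.Periodic E (1 : ℝ) := by
    intro w
    by_cases hw : 0 < w.im
    · have h1 : 0 < (w + (1 : ℝ)).im := by simpa using hw
      simp only [hE, hw, h1, if_true]
      have h2 : Φ (w + (1 : ℝ)) = Φ w + t * Complex.I := by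
        rw [← ht w hw]
        simp
      rw [h2, Complex.exp_eq_exp_iff_exists_int]
      exact ⟨k, by push_cast; ring⟩
    · have h1 : ¬ 0 < (w + (1 : ℝ)).im := by simpa using hw
      simp only [hE, hw, h1, if_false]
  have hEan : ∀ w : ℂ, 0 < w.im → DifferentiableAt ℂ E w := by
    intro w hw
    have h1 : E =ᶠ[𝓝 w] fun w =>
        Complex.exp (Φ w - t * Complex.I * w + 2 * Real.pi * Complex.I * k * w) := by
      filter_upwards [(isOpen_lt continuous_const Complex.continuous_im).mem_nhds hw] with x hx
      simp only [hE, show 0 < x.im from hx, if_true]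
    rw [h1.differentiableAt_iff]
    have := (hΦ w hw).differentiableAt
    fun_prop
  have hEnorm : ∀ w : ℂ, 0 < w.im →
      ‖E w‖ = Real.exp (v (Function.Periodic.qParam 1 w) + (t - 2 * Real.pi * k) * w.im) := by
    intro w hw
    simp only [hE, hw, if_true, Complex.norm_exp]
    congr 1
    rw [← hre w hw]
    simp
    ring
  have him : ∀ᶠ w in comap Complex.im atTop, 0 < w.im :=
    (eventually_gt_atTop (0 : ℝ)).comap Complex.im
  have hbd : (comap Complex.im atTop).BoundedAtFilter E := by
    rw [Filter.BoundedAtFilter, Asymptotics.isBigO_iff]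
    refine ⟨Real.exp M, ?_⟩
    filter_upwards [him, (Function.Periodic.qParam_tendsto one_pos).eventually hM] with w hw hwM
    rw [hEnorm w hw]
    simp only [Pi.one_apply, norm_one, mul_one]
    gcongr
    have h1 : t - 2 * Real.pi * k ≤ 0 := by
      have : (k : ℝ) ≤ 2 * Real.pi * k := by
        have h2 := Real.pi_gt_three
        have h3 : (0 : ℝ) ≤ k := k.cast_nonneg
        nlinarith
      linarith
    nlinarith [mul_nonneg (neg_nonneg.2 h1) hw.le]
  -- In the coordinate `z = exp (2 π i w)` the periodic function descends to the punctured disk, and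
  -- boundedness removes the singularity at `0`.
  set e := Function.Periodic.cuspFunction 1 E with he
  have he0 : DifferentiableAt ℂ e 0 := Function.Periodic.differentiableAt_cuspFunction_zero one_pos
    hEper (him.mono hEan) hbd
  have hean : AnalyticAt ℂ e 0 := by
    rw [Complex.analyticAt_iff_eventually_differentiableAt]
    have := Function.Periodic.eventually_differentiableAt_cuspFunction_nhds_ne_zero one_pos
      hEper (him.mono hEan)
    rw [eventually_nhdsWithin_iff] at this
    filter_upwards [this] with z hz
    by_cases h : z = 0
    · rw [h]; exact he0
    · exact hz h
  have hpt : ∀ z : ℂ, z ≠ 0 → ‖z‖ < 1 →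
      ‖e z‖ = Real.exp (v z + (t - 2 * Real.pi * k) * (-1 / (2 * Real.pi) * Real.log ‖z‖)) := by
    intro z hz hz1
    have h1 : 0 < (Function.Periodic.invQParam 1 z).im := by
      rw [Function.Periodic.im_invQParam]
      refine mul_pos_of_neg_of_neg (div_neg_of_neg_of_pos (by norm_num) (by positivity)) ?_
      exact Real.log_neg (norm_pos_iff.2 hz) hz1
    have h2 := hEnorm _ h1
    rw [Function.Periodic.qParam_right_inv one_ne_zero hz, Function.Periodic.im_invQParam] at h2
    rw [← h2, he, Function.Periodic.cuspFunction_eq_of_nonzero _ _ hz]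
  have hsmall : ∀ᶠ z in 𝓝[≠] (0 : ℂ), z ≠ 0 ∧ ‖z‖ < 1 := by
    filter_upwards [self_mem_nhdsWithin, nhdsWithin_le_nhds (ball_mem_nhds (0 : ℂ) one_pos)]
      with z h1 h2
    exact ⟨h1, by simpa using h2⟩
  have hnz : ¬ ∀ᶠ z in 𝓝 (0 : ℂ), e z = 0 := by
    intro h
    obtain ⟨z, h1, h2, h3⟩ := ((h.filter_mono nhdsWithin_le_nhds).and hsmall).exists (f := 𝓝[≠] (0 : ℂ))
    have := hpt z h2 h3
    rw [h1, norm_zero] at this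
    exact (Real.exp_pos _).ne this
  -- Logarithms of the moduli in `e = z ^ j g` yield the coefficient: `j` from the zero of `e`, and
  -- the rest from `Im w = -log |z| / (2 π)`.
  obtain ⟨j, g, hg, hg0, hge⟩ := hean.exists_eventuallyEq_pow_smul_nonzero_iff.2 hnz
  refine ⟨j + (t - 2 * Real.pi * k) / (2 * Real.pi), g, hg, hg0, ?_⟩
  filter_upwards [nhdsWithin_le_nhds hge, hsmall,
    nhdsWithin_le_nhds (hg.continuousAt.eventually_ne hg0)] with z h1 h2 h3
  have h4 := congrArg Real.log (hpt z h2.1 h2.2)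
  rw [Real.log_exp, h1, sub_zero, norm_smul, norm_pow, Real.log_mul
    (pow_ne_zero _ (norm_ne_zero_iff.2 h2.1)) (norm_ne_zero_iff.2 h3), Real.log_pow] at h4
  have hpi := Real.pi_pos.ne'
  have h5 : (t - 2 * Real.pi * k) * (-1 / (2 * Real.pi) * Real.log ‖z‖) =
    - ((t - 2 * Real.pi * k) / (2 * Real.pi) * Real.log ‖z‖) := by ring
  linarith

/-- Bôcher's theorem is local; globally `v - c log |z|` is harmonic off `0`, and the value `log |g
0|` fills the puncture. -/
theorem exists_harmonicOnNhd_add_log {v : ℂ → ℝ} {R : ℝ} (hR : 1 < R)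
    (hv : HarmonicOnNhd v (ball 0 R \ {0})) {M : ℝ} (hM : ∀ᶠ z in 𝓝[≠] (0 : ℂ), v z ≤ M) :
    ∃ (c : ℝ) (h : ℂ → ℝ), HarmonicOnNhd h (ball 0 R) ∧
      ∀ z ∈ ball (0 : ℂ) R \ {0}, v z = c * Real.log ‖z‖ + h z := by
  classical
  obtain ⟨c, g, hg, hg0, he⟩ := exists_eventually_eq_log_add_log_norm
    (hv.mono (Set.sdiff_subset_sdiff_left (ball_subset_ball hR.le))) hM
  set h : ℂ → ℝ := fun z => if z = 0 then Real.log ‖g 0‖ else v z - c * Real.log ‖z‖ with hh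
  refine ⟨c, h, fun z hz => ?_, fun z hz => ?_⟩
  · by_cases hz0 : z = 0
    · subst hz0
      refine (harmonicAt_congr_nhds ?_).2 (hg.harmonicAt_log_norm hg0)
      rw [eventually_nhdsWithin_iff] at he
      filter_upwards [he] with w hw
      by_cases hw0 : w = 0
      · simp [hh, hw0]
      · simp only [hh, hw0, if_false]
        rw [hw hw0]
        ring
    · have h1 : HarmonicAt (v - c • fun z : ℂ => Real.log ‖z‖) z :=
        (hv z ⟨hz, hz0⟩).sub ((analyticAt_id.harmonicAt_log_norm hz0).const_smul)
      refine (harmonicAt_congr_nhds ?_).2 h1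
      filter_upwards [isOpen_ne.mem_nhds hz0] with w hw
      replace hw : w ≠ 0 := hw
      simp [hh, hw]
  · have : z ≠ 0 := hz.2
    simp [hh, this]

/-! ### Operators that decay along an orthonormal sequence. -/

section Decay

variable {E : Type*} [NormedAddCommGroup E] [InnerProductSpace ℂ E]

theorem norm_sum_smul_le_of_orthogonal {w : ℤ → E} (hw : ∀ k l, k ≠ l → inner ℂ (w k) (w l) = 0)
    {δ : ℝ} (hδ : 0 ≤ δ) (s : Finset ℤ) (c : ℤ → ℂ) (h : ∀ k ∈ s, c k ≠ 0 → ‖w k‖ ≤ δ) :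
    ‖∑ k ∈ s, c k • w k‖ ≤ δ * √(∑ k ∈ s, ‖c k‖ ^ 2) := by
  have h1 : ‖∑ k ∈ s, c k • w k‖ ^ 2 = ∑ k ∈ s, ‖c k • w k‖ ^ 2 := by
    have h2 : ((‖∑ k ∈ s, c k • w k‖ ^ 2 : ℝ) : ℂ) = ((∑ k ∈ s, ‖c k • w k‖ ^ 2 : ℝ) : ℂ) := by
      push_cast
      have e1 := inner_self_eq_norm_sq_to_K (𝕜 := ℂ) (∑ k ∈ s, c k • w k)
      refine (e1.symm.trans ?_)
      rw [sum_inner]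
      refine Finset.sum_congr rfl fun k hk => ?_
      rw [inner_sum, Finset.sum_eq_single k]
      · exact inner_self_eq_norm_sq_to_K _
      · intro l _ hl
        rw [inner_smul_left, inner_smul_right, hw k l hl.symm]
        simp
      · exact fun h => absurd hk h
    exact_mod_cast h2
  refine le_of_sq_le_sq ?_ (by positivity)
  rw [h1, mul_pow, Real.sq_sqrt (Finset.sum_nonneg fun _ _ => by positivity), Finset.mul_sum]
  refine Finset.sum_le_sum fun k hk => ?_
  by_cases hc : c k = 0
  · simp [hc]
  · rw [norm_smul, mul_pow, mul_comm]
    have := h k hk hc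
    gcongr

/-- The operator `T` is `O(C / N)` on the finite combinations of the vectors `e k` with
`|k| ≥ N`. -/
def DecaysAlong (e : ℤ → E) (T : E →L[ℂ] E) (C : ℝ) : Prop :=
  ∀ (N : ℕ) (s : Finset ℤ) (c : ℤ → ℂ), (∀ k : ℤ, k.natAbs < N → c k = 0) →
    ‖T (∑ k ∈ s, c k • e k)‖ ≤ C / (N + 1) * √(∑ k ∈ s, ‖c k‖ ^ 2)

variable {e : ℤ → E}

theorem DecaysAlong.add {S T : E →L[ℂ] E} {C D : ℝ} (hS : DecaysAlong e S C)
    (hT : DecaysAlong e T D) : DecaysAlong e (S + T) (C + D) := by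
  intro N s c hc
  rw [add_apply, add_div, add_mul]
  exact (norm_add_le _ _).trans (add_le_add (hS N s c hc) (hT N s c hc))

theorem DecaysAlong.smul {T : E →L[ℂ] E} {C : ℝ} (hT : DecaysAlong e T C) (a : ℂ) :
    DecaysAlong e (a • T) (‖a‖ * C) := by
  intro N s c hc
  rw [smul_apply, norm_smul, mul_div_assoc, mul_assoc]
  exact mul_le_mul_of_nonneg_left (hT N s c hc) (norm_nonneg _)

theorem DecaysAlong.hasSum {T : ℤ → E →L[ℂ] E} {C : ℤ → ℝ} {S : E →L[ℂ] E}
    (hT : ∀ j, DecaysAlong e (T j) (C j)) (hS : HasSum T S) (hC : Summable C) :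
    DecaysAlong e S (∑' j, C j) := by
  intro N s c hc
  have h1 : HasSum (fun j => T j (∑ k ∈ s, c k • e k)) (S (∑ k ∈ s, c k • e k)) :=
    hS.mapL (ContinuousLinearMap.apply ℂ E (∑ k ∈ s, c k • e k))
  have h2 : HasSum (fun j => C j / (N + 1) * √(∑ k ∈ s, ‖c k‖ ^ 2))
      ((∑' j, C j) / (N + 1) * √(∑ k ∈ s, ‖c k‖ ^ 2)) :=
    (hC.hasSum.div_const _).mul_right _
  exact h1.norm_le_of_bounded h2 fun j => hT j N s c hc

/-- The vectors `T (e k)` need not be orthogonal themselves; it suffices that they be images of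
small orthogonal vectors under one contraction. This leaves the freedom to alter `w k` within the
kernel of `S`. -/
theorem decaysAlong_of_orthogonal {T S : E →L[ℂ] E} (hS : ‖S‖ ≤ 1) {w : ℤ → E}
    (hw : ∀ k l, k ≠ l → inner ℂ (w k) (w l) = 0) (hT : ∀ k, T (e k) = S (w k)) {C : ℝ}
    (hC : 0 ≤ C) (hwC : ∀ k, ‖w k‖ ≤ C / (k.natAbs + 1)) : DecaysAlong e T C := by
  intro N s c hc
  have h1 : T (∑ k ∈ s, c k • e k) = S (∑ k ∈ s, c k • w k) := by
    simp only [map_sum, map_smul, hT]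
  rw [h1]
  refine (S.le_of_opNorm_le hS _).trans ?_
  rw [one_mul]
  refine norm_sum_smul_le_of_orthogonal hw (by positivity) s c fun k _ hk => ?_
  refine (hwC k).trans ?_
  have : (N : ℝ) ≤ k.natAbs := by
    exact_mod_cast not_lt.1 fun h => hk (hc k h)
  gcongr

/-- Take for `U` the span of the basis vectors with `|k| < N`. Off `U` those coefficients vanish,
and the estimate on finite sums passes to the limit by continuity of `T` and Bessel's inequality. -/
theorem DecaysAlong.exists_submodule [CompleteSpace E] {V : Submodule ℂ E} [V.HasOrthogonalProjection]
    (b : HilbertBasis ℤ ℂ V) {T : E →L[ℂ] E} {C : ℝ} (hC : 0 ≤ C)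
    (hT : DecaysAlong (fun k => (b k : E)) T C) (hTV : T ∘L V.starProjection = T) (N : ℕ) :
    ∃ U : Submodule ℂ E, ∃ _ : FiniteDimensional ℂ U,
      Module.finrank ℂ U ≤ 2 * N ∧ ∀ x ∈ Uᗮ, ‖T x‖ ≤ C / (N + 1) * ‖x‖ := by
  classical
  set t : Finset E := (Finset.Ioo (-(N : ℤ)) N).image fun k => (b k : E)
  refine ⟨Submodule.span ℂ t, inferInstance, ?_, fun x hx => ?_⟩
  · refine (finrank_span_finset_le_card t).trans (Finset.card_image_le.trans ?_)
    rw [Int.card_Ioo]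
    omega
  · set y : V := V.orthogonalProjectionOnto x with hy
    have hTx : T x = T (y : E) := by
      conv_lhs => rw [← hTV]
      rfl
    have hyx : ‖y‖ ≤ ‖x‖ := V.norm_orthogonalProjectionOnto_apply_le x
    have hrepr : ∀ k, b.repr y k = inner ℂ (b k : E) x := by
      intro k
      rw [b.repr_apply_apply, hy, Submodule.inner_orthogonalProjectionOnto_eq_of_mem_left]
    have h0 : ∀ k : ℤ, k.natAbs < N → b.repr y k = 0 := by
      intro k hk
      rw [hrepr]
      refine (Submodule.mem_orthogonal _ _).1 hx _ (Submodule.subset_span ?_)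
      exact Finset.mem_coe.2 (Finset.mem_image_of_mem _ (Finset.mem_Ioo.2 (by omega)))
    have h1 : HasSum (fun k => b.repr y k • (b k : E)) (y : E) := by
      simpa using (b.hasSum_repr y).mapL V.subtypeL
    have h2 : Tendsto (fun s : Finset ℤ => ‖T (∑ k ∈ s, b.repr y k • (b k : E))‖) atTop
        (𝓝 ‖T (y : E)‖) := ((T.continuous.tendsto _).comp h1).norm
    rw [hTx]
    refine le_of_tendsto h2 (Eventually.of_forall fun s => (hT N s _ h0).trans ?_)
    have h3 : √(∑ k ∈ s, ‖b.repr y k‖ ^ 2) ≤ ‖y‖ := by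
      rw [Real.sqrt_le_left (norm_nonneg _)]
      simp_rw [b.repr_apply_apply]
      exact b.orthonormal.sum_inner_products_le y
    have : √(∑ k ∈ s, ‖b.repr y k‖ ^ 2) ≤ ‖x‖ := h3.trans hyx
    gcongr

end Decay

/-! ### Bounded multiplication operators. -/

section Multiplication

variable {α : ℝ}

/-- A multiplication operator that is defined everywhere on the range of a bounded operator gives a
bounded operator. -/
theorem exists_clm_ae_eq_mul (P : L2 α →L[ℂ] L2 α) (φ : ℂ → ℂ)
    (hφ : ∀ f, MemLp (fun z => φ z * P f z) 2 (dA α)) :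
    ∃ M : L2 α →L[ℂ] L2 α, ∀ f, M f =ᵐ[dA α] fun z => φ z * P f z := by
  set M : L2 α →ₗ[ℂ] L2 α :=
    { toFun := fun f => (hφ f).toLp
      map_add' := by
        intro f g
        refine Lp.ext ?_
        filter_upwards [(hφ (f + g)).coeFn_toLp, (hφ f).coeFn_toLp, (hφ g).coeFn_toLp,
          Lp.coeFn_add (hφ f).toLp (hφ g).toLp, Lp.coeFn_add (P f) (P g)] with z h1 h2 h3 h4 h5
        rw [h1, h4, Pi.add_apply, h2, h3, map_add, h5, Pi.add_apply, mul_add]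
      map_smul' := by
        intro c f
        refine Lp.ext ?_
        filter_upwards [(hφ (c • f)).coeFn_toLp, (hφ f).coeFn_toLp,
          Lp.coeFn_smul c (hφ f).toLp, Lp.coeFn_smul c (P f)] with z h1 h2 h4 h5
        rw [h1, RingHom.id_apply, h4, Pi.smul_apply, h2, map_smul, h5, Pi.smul_apply, smul_eq_mul,
          smul_eq_mul, mul_left_comm] } with hM
  have hMf : ∀ f, M f =ᵐ[dA α] fun z => φ z * P f z := fun f => (hφ f).coeFn_toLp
  have hc : Continuous M := by
    -- Closed graph theorem: along a common subsequence both `P (u n)` and `M (u n)` converge almost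
    -- everywhere, which identifies the limit.
    refine M.continuous_of_seq_closed_graph fun u x y hu hy => ?_
    have hPu : Tendsto (P ∘ u) atTop (𝓝 (P x)) := (P.continuous.tendsto x).comp hu
    obtain ⟨ns, hns, h1⟩ := (tendstoInMeasure_of_tendsto_Lp hPu).exists_seq_tendsto_ae
    obtain ⟨ms, hms, h2⟩ := (tendstoInMeasure_of_tendsto_Lp
      (hy.comp hns.tendsto_atTop)).exists_seq_tendsto_ae
    refine Lp.ext ?_
    filter_upwards [h1, h2, hMf x, ae_all_iff.2 fun n => hMf (u n)] with z h1 h2 h3 h4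
    rw [h3]
    refine tendsto_nhds_unique h2 ?_
    simp only [Function.comp_apply, h4]
    exact (h1.comp hms.tendsto_atTop).const_mul _
  exact ⟨⟨M, hc⟩, hMf⟩

theorem norm_le_mul_norm_of_ae_eq {f g : L2 α} {φ : ℂ → ℂ} (h : f =ᵐ[dA α] fun z => φ z * g z)
    {K : ℝ} (hK : ∀ z ∈ ball (0 : ℂ) 1, ‖φ z‖ ≤ K) : ‖f‖ ≤ K * ‖g‖ := by
  refine Lp.norm_le_mul_norm_of_ae_le_mul ?_
  filter_upwards [h, ae_dA_mem_ball α] with z h1 h2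
  rw [h1, norm_mul]
  exact mul_le_mul_of_nonneg_right (hK z h2) (norm_nonneg _)

theorem memLp_mul_of_bound (f : L2 α) {φ : ℂ → ℂ} (hφ : AEStronglyMeasurable φ (dA α))
    {K : ℝ} (hK : ∀ z ∈ ball (0 : ℂ) 1, ‖φ z‖ ≤ K) : MemLp (fun z => φ z * f z) 2 (dA α) := by
  refine (Lp.memLp f).of_le_mul (c := K) (hφ.mul (Lp.aestronglyMeasurable f)) ?_
  filter_upwards [ae_dA_mem_ball α] with z h2
  rw [norm_mul]
  exact mul_le_mul_of_nonneg_right (hK z h2) (norm_nonneg _)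

theorem aestronglyMeasurable_of_continuousOn {φ : ℂ → ℂ} (hφ : ContinuousOn φ (ball 0 1)) :
    AEStronglyMeasurable φ (dA α) :=
  (hφ.aestronglyMeasurable measurableSet_ball).mono_ac (dA_absolutelyContinuous α)

theorem exists_norm_le_of_continuousOn {φ : ℂ → ℂ} (hφ : ContinuousOn φ (closedBall 0 1)) :
    ∃ K : ℝ, ∀ z ∈ ball (0 : ℂ) 1, ‖φ z‖ ≤ K := by
  obtain ⟨K, hK⟩ := (isCompact_closedBall (0 : ℂ) 1).exists_bound_of_continuousOn hφ
  exact ⟨K, fun z hz => hK z (ball_subset_closedBall hz)⟩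

theorem exists_clm_ae_eq_mul_of_continuousOn (α : ℝ) {φ : ℂ → ℂ}
    (hφ : ContinuousOn φ (closedBall 0 1)) :
    ∃ M : L2 α →L[ℂ] L2 α, ∀ f, M f =ᵐ[dA α] fun z => φ z * f z := by
  obtain ⟨K, hK⟩ := exists_norm_le_of_continuousOn hφ
  exact exists_clm_ae_eq_mul (ContinuousLinearMap.id ℂ _) φ fun f => memLp_mul_of_bound f
    (aestronglyMeasurable_of_continuousOn (hφ.mono ball_subset_closedBall)) hK

/-- Multiplication by a harmonic function is the norm-convergent sum of the multiplications by its
harmonic monomials. -/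
theorem hasSum_mul_harmonicMonomial {h : ℂ → ℂ} {b : ℤ → ℂ} {R : ℝ} (hR : 1 < R)
    (hb : ∀ z ∈ ball (0 : ℂ) R, HasSum (fun k => b k * harmonicMonomial k z) (h z))
    {M : L2 α →L[ℂ] L2 α} (hM : ∀ f, M f =ᵐ[dA α] fun z => h z * f z)
    {X : ℤ → L2 α →L[ℂ] L2 α} (hX : ∀ j f, X j f =ᵐ[dA α] fun z => harmonicMonomial j z * f z) :
    HasSum (fun j => b j • X j) M := by
  have hsum : Summable fun j => ‖b j‖ := by
    simpa using summable_norm_mul_pow hb zero_le_one hR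
  rw [HasSum, SummationFilter.unconditional_filter, tendsto_iff_norm_sub_tendsto_zero]
  refine squeeze_zero (fun _ => norm_nonneg _) (fun s => ?_) (tendsto_tsum_compl_atTop_zero fun j => ‖b j‖)
  rw [norm_sub_rev]
  refine ContinuousLinearMap.opNorm_le_bound _ (tsum_nonneg fun _ => norm_nonneg _) fun f => ?_
  have hae : (M - ∑ j ∈ s, b j • X j) f =ᵐ[dA α]
      fun z => (h z - ∑ j ∈ s, b j * harmonicMonomial j z) * f z := by
    have h1 : ((∑ j ∈ s, b j • X j) f : L2 α) =ᵐ[dA α]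
        fun z => (∑ j ∈ s, b j * harmonicMonomial j z) * f z := by
      rw [sum_apply]
      have h2 := Lp.coeFn_finsetSum s (fun j => (b j • X j) f)
      have h3 : ∀ᵐ z ∂(dA α), ∀ j, (b j • X j) f z = b j * (harmonicMonomial j z * f z) := by
        rw [ae_all_iff]
        intro j
        filter_upwards [hX j f, Lp.coeFn_smul (b j) (X j f)] with z h4 h5
        rw [smul_apply, h5, Pi.smul_apply, h4, smul_eq_mul]
      filter_upwards [h2, h3] with z h4 h5
      rw [h4, Finset.sum_apply, Finset.sum_mul]
      refine Finset.sum_congr rfl fun j _ => ?_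
      rw [h5, mul_assoc]
    filter_upwards [h1, hM f, Lp.coeFn_sub (M f) ((∑ j ∈ s, b j • X j) f)] with z h1 h2 h3
    rw [sub_apply, h3, Pi.sub_apply, h1, h2, sub_mul]
  -- The monomials are bounded by `1` on the disk, so the sup norm of the remainder is at most the
  -- tail of `∑ ‖b j‖`.
  refine norm_le_mul_norm_of_ae_eq hae fun z hz => ?_
  have hzR : z ∈ ball (0 : ℂ) R := ball_subset_ball hR.le hz
  have h1 := (hb z hzR).summable
  rw [← (hb z hzR).tsum_eq, ← h1.sum_add_tsum_compl (s := s), add_sub_cancel_left]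
  refine tsum_of_norm_bounded (hsum.subtype _).hasSum fun j => ?_
  rw [norm_mul, norm_harmonicMonomial]
  exact mul_le_of_le_one_right (norm_nonneg _)
    (pow_le_one₀ (norm_nonneg _) (mem_ball_zero_iff.1 hz).le)

end Multiplication

/-! ### Decay estimates for monomial, harmonic and logarithmic symbols. -/

section Symbols

variable {α : ℝ}

theorem norm_sq_eq_integral {f : L2 α} {F : ℂ → ℂ} (hf : f =ᵐ[dA α] F) :
    ‖f‖ ^ 2 = ∫ z, ‖F z‖ ^ 2 ∂(dA α) := by
  have hF : MemLp F 2 (dA α) := (memLp_congr_ae hf).1 (Lp.memLp f)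
  rw [← norm_toLp_sq hF]
  congr 2
  exact Lp.ext (hf.trans hF.coeFn_toLp.symm)

/-- The constant in the comparison of weighted norms of monomials. -/
noncomputable def weightConst (α : ℝ) : ℝ := √(4 * (α + 1) * (α + 2) * Real.exp (α + 1))

/-- The squared bound integrates to a moment of weight `α + 2`, and `radialMoment_add_two_le`
compares it with the squared norm of the monomial. The gain `1 / |k|²` there becomes `1 / |k|` for
norms. -/
theorem norm_le_of_radial_bound (hα : -1 < α) {f : L2 α} {F : ℂ → ℂ} (hf : f =ᵐ[dA α] F) {k : ℤ}
    {m : ℕ} (hm : 2 * m ≤ k.natAbs) {a : ℝ} (ha : 0 ≤ a)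
    (hF : ∀ z ∈ ball (0 : ℂ) 1, ‖F z‖ ≤ a * ((1 - ‖z‖ ^ 2) * ‖z‖ ^ (k.natAbs - m))) :
    ‖f‖ ≤ a * weightConst α / (k.natAbs + 1) * ‖monomialLp hα k‖ := by
  have := isFiniteMeasure_dA hα
  have hMem : MemLp F 2 (dA α) := (memLp_congr_ae hf).1 (Lp.memLp f)
  have a1 : 0 < α + 1 := by linarith
  have a2 : 0 < α + 2 := by linarith
  refine le_of_sq_le_sq ?_ (by unfold weightConst; positivity)
  have hmem' : MemLp (fun z : ℂ => (1 - ‖z‖ ^ 2) ^ 2 * ‖z‖ ^ (2 * (k.natAbs - m))) 1 (dA α) := by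
    refine MemLp.of_bound (by fun_prop : Continuous _).aestronglyMeasurable 1 ?_
    filter_upwards [ae_dA_mem_ball α] with z hz
    have hz1 : ‖z‖ < 1 := by simpa using hz
    have h0 : 0 ≤ 1 - ‖z‖ ^ 2 := by nlinarith [norm_nonneg z]
    rw [Real.norm_of_nonneg (by positivity)]
    exact mul_le_one₀ (pow_le_one₀ h0 (by nlinarith [norm_nonneg z])) (by positivity)
      (pow_le_one₀ (norm_nonneg _) hz1.le)
  have h1 : ‖f‖ ^ 2 ≤ a ^ 2 * (2 * (α + 1) * radialMoment (α + 2) (k.natAbs - m)) := by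
    rw [norm_sq_eq_integral hf, ← integral_dA_sq_mul_norm_pow hα, ← integral_const_mul]
    refine integral_mono_ae hMem.norm.integrable_sq ((memLp_one_iff_integrable.1 hmem').const_mul _) ?_
    filter_upwards [ae_dA_mem_ball α] with z hz
    calc ‖F z‖ ^ 2 ≤ (a * ((1 - ‖z‖ ^ 2) * ‖z‖ ^ (k.natAbs - m))) ^ 2 := by
          gcongr
          exact hF z hz
      _ = _ := by
        rw [mul_pow, mul_pow, ← pow_mul, mul_comm (k.natAbs - m)]
  refine h1.trans ?_
  calc _ ≤ a ^ 2 * (2 * (α + 1) * (4 * (α + 1) * (α + 2) * Real.exp (α + 1) /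
          ((k.natAbs : ℝ) + 1) ^ 2 * radialMoment α k.natAbs)) := by
        gcongr
        exact radialMoment_add_two_le hα hm
    _ = _ := by
      rw [mul_pow, norm_monomialLp_sq, div_pow, mul_pow, weightConst, Real.sq_sqrt (by positivity)]
      ring

theorem memLp_log (hα : -1 < α) : MemLp (fun z : ℂ => (Real.log ‖z‖ : ℂ)) 2 (dA α) := by
  have hm : Measurable fun z : ℂ => (Real.log ‖z‖ : ℂ) := by fun_prop
  rw [memLp_two_iff_integrable_sq_norm hm.aestronglyMeasurable]
  simp only [Complex.norm_real, Real.norm_eq_abs, sq_abs]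
  refine integrable_dA_radial (φ := fun r => Real.log r ^ 2) hα ?_
  have h0 := (intervalIntegrable_pow_mul_one_sub_sq_rpow hα 0).const_mul 4
  rw [intervalIntegrable_iff_integrableOn_Ioo_of_le zero_le_one] at h0 ⊢
  refine h0.mono' (by fun_prop : Measurable fun r : ℝ =>
    r * Real.log r ^ 2 * (1 - r ^ 2) ^ α).aestronglyMeasurable ?_
  refine (ae_restrict_iff' measurableSet_Ioo).2 (ae_of_all _ fun r hr => ?_)
  have hr0 : 0 < r := hr.1
  have hw : 0 ≤ (1 - r ^ 2) ^ α := Real.rpow_nonneg (by nlinarith [hr.2]) _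
  have h1 : r * Real.log r ^ 2 ≤ 4 := by
    -- Using `|x log x| < 1` at `x = √r` gives `r (log r)² ≤ 4`, which removes the singularity at
    -- `0`.
    have h2 := Real.abs_log_mul_self_lt √r (Real.sqrt_pos.2 hr0) (Real.sqrt_le_one.2 hr.2.le)
    have h3 : (Real.log √r * √r) ^ 2 ≤ 1 := by
      rw [← sq_abs]
      exact pow_le_one₀ (abs_nonneg _) h2.le
    rw [mul_pow, Real.sq_sqrt hr0.le, Real.log_sqrt hr0.le] at h3
    linarith
  rw [Real.norm_of_nonneg (by positivity), pow_zero, one_mul]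
  gcongr

/-- For `|z| ≤ 1/2` the harmonic representative is bounded and the logarithm is square-integrable;
for `|z| > 1/2` the logarithm is bounded by `log 2`. -/
theorem memLp_log_mul (hα : -1 < α) {f : L2 α} (hf : f ∈ harmonicSubspace α) :
    MemLp (fun z => (Real.log ‖z‖ : ℂ) * f z) 2 (dA α) := by
  obtain ⟨g, hg, hfg⟩ := hf
  obtain ⟨K, hK⟩ := (isCompact_closedBall (0 : ℂ) (1 / 2)).exists_bound_of_continuousOn
    (hg.continuousOn.mono (closedBall_subset_ball (by norm_num)))
  have h1 : MemLp (fun z => K * |Real.log ‖z‖| + Real.log 2 * ‖f z‖) 2 (dA α) := by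
    have h2 : MemLp (fun z : ℂ => |Real.log ‖z‖|) 2 (dA α) := by
      simpa using (memLp_log hα).norm
    exact (h2.const_mul K).add ((Lp.memLp f).norm.const_mul _)
  refine h1.mono' ((memLp_log hα).1.mul (Lp.aestronglyMeasurable f)) ?_
  filter_upwards [ae_dA_mem_ball α, hfg, ae_dA_ne_zero α] with z hz hz2 hz0
  have hz1 : ‖z‖ < 1 := by simpa using hz
  have hp : 0 < ‖z‖ := norm_pos_iff.2 hz0
  have hl2 : 0 < Real.log 2 := Real.log_pos (by norm_num)
  have hK0 : 0 ≤ K := (norm_nonneg _).trans (hK 0 (by simp))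
  rw [norm_mul, Complex.norm_real, Real.norm_eq_abs]
  rcases le_or_gt ‖z‖ (1 / 2) with h | h
  · have h2 := hK z (by simpa using h)
    rw [← hz2] at h2
    have h3 := mul_le_mul_of_nonneg_left h2 (abs_nonneg (Real.log ‖z‖))
    have h4 : 0 ≤ Real.log 2 * ‖f z‖ := by positivity
    linarith
  · have h2 : |Real.log ‖z‖| ≤ Real.log 2 := by
      rw [abs_of_nonpos (Real.log_nonpos hp.le hz1.le), ← Real.log_inv]
      refine Real.log_le_log (by positivity) ?_
      rw [inv_le_comm₀ hp (by norm_num)]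
      linarith
    have h3 := mul_le_mul_of_nonneg_right h2 (norm_nonneg (f z))
    have h4 : 0 ≤ K * |Real.log ‖z‖| := by positivity
    linarith

theorem harmonicProj_mem (α : ℝ) (f : L2 α) : harmonicProj α f ∈ harmonicSubspace α :=
  Submodule.starProjection_apply_mem _ f

theorem harmonicProj_eq_self {f : L2 α} (hf : f ∈ harmonicSubspace α) : harmonicProj α f = f :=
  Submodule.starProjection_eq_self_iff.2 hf

theorem norm_one_sub_harmonicProj_le (α : ℝ) : ‖1 - harmonicProj α‖ ≤ 1 := by
  have h : 1 - harmonicProj α = (harmonicSubspace α)ᗮ.starProjection :=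
    (Submodule.starProjection_orthogonal' _).symm
  rw [h]
  exact Submodule.starProjection_norm_le _

/-- The normalised harmonic monomials. -/
noncomputable def unitMonomial (hα : -1 < α) (k : ℤ) : L2 α :=
  (‖monomialLp hα k‖ : ℂ)⁻¹ • monomialLp hα k

theorem norm_inv_smul_le (hα : -1 < α) (k : ℤ) {y : L2 α} {D : ℝ}
    (hy : ‖y‖ ≤ D * ‖monomialLp hα k‖) : ‖(‖monomialLp hα k‖ : ℂ)⁻¹ • y‖ ≤ D := by
  have h := norm_monomialLp_pos hα k
  rw [norm_smul, norm_inv, Complex.norm_real, norm_norm, inv_mul_le_iff₀ h, mul_comm]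
  exact hy

/-- The core Hankel estimate. Since `1 - ℙ` kills harmonic functions, the product of the `j`-th and
`k`-th monomials may be corrected by the `(j + k)`-th one. What remains is small and still of pure
frequency `j + k`, hence orthogonal for different `k`. -/
theorem decaysAlong_mul_harmonicMonomial (hα : -1 < α) (j : ℤ) {X : L2 α →L[ℂ] L2 α}
    (hX : ∀ f, X f =ᵐ[dA α] fun z => harmonicMonomial j z * f z) :
    DecaysAlong (unitMonomial hα) ((1 - harmonicProj α) ∘L X)
      ((weightConst α + 2) * (j.natAbs + 1)) := by
  classical
  have hw0 : 0 ≤ weightConst α := Real.sqrt_nonneg _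
  set y : ℤ → L2 α := fun k => X (monomialLp hα k) -
    if 2 * j.natAbs ≤ k.natAbs then monomialLp hα (j + k) else 0 with hy
  have hyae : ∀ k, y k =ᵐ[dA α] fun z => harmonicMonomial j z * harmonicMonomial k z -
      if 2 * j.natAbs ≤ k.natAbs then harmonicMonomial (j + k) z else 0 := by
    intro k
    have h1 : X (monomialLp hα k) =ᵐ[dA α] fun z => harmonicMonomial j z * harmonicMonomial k z := by
      filter_upwards [hX (monomialLp hα k), coeFn_monomialLp hα k] with z h1 h2
      rw [h1, h2]
    by_cases hk : 2 * j.natAbs ≤ k.natAbs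
    · simp only [hy, hk, if_true]
      filter_upwards [Lp.coeFn_sub (X (monomialLp hα k)) (monomialLp hα (j + k)), h1,
        coeFn_monomialLp hα (j + k)] with z h2 h3 h4
      rw [h2, Pi.sub_apply, h3, h4]
    · simpa only [hy, hk, if_false, sub_zero] using h1
  have hrot : ∀ k, ∀ (ω : Circle) z, (harmonicMonomial j (ω * z) * harmonicMonomial k (ω * z) -
      if 2 * j.natAbs ≤ k.natAbs then harmonicMonomial (j + k) (ω * z) else 0) = (ω : ℂ) ^ (j + k) *
      (harmonicMonomial j z * harmonicMonomial k z -
      if 2 * j.natAbs ≤ k.natAbs then harmonicMonomial (j + k) z else 0) := by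
    intro k ω z
    simp only [harmonicMonomial_circle_mul, zpow_add₀ (Circle.coe_ne_zero ω)]
    split_ifs <;> ring
  have hnorm : ∀ k, ‖y k‖ ≤ (weightConst α + 2) * (j.natAbs + 1) / (k.natAbs + 1) *
      ‖monomialLp hα k‖ := by
    intro k
    by_cases hk : 2 * j.natAbs ≤ k.natAbs
    · refine (norm_le_of_radial_bound hα (hyae k) (a := j.natAbs) hk (by positivity)
        fun z hz => ?_).trans ?_
      · simp only [hk, if_true]
        exact norm_harmonicMonomial_mul_sub j k hk hz
      · gcongr ?_ / _ * _
        rw [mul_comm]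
        gcongr
        · linarith
        · linarith
    -- For `|k| < 2 |j|` nothing is subtracted, and the trivial bound suffices because `|k| + 1 ≤ 2
    -- (|j| + 1)`; this accounts for the `+ 2` in the constant.
    · have h1 : ‖y k‖ ≤ 1 * ‖monomialLp hα k‖ := by
        simp only [hy, hk, if_false, sub_zero]
        refine norm_le_mul_norm_of_ae_eq (hX _) fun z hz => ?_
        rw [norm_harmonicMonomial]
        exact pow_le_one₀ (norm_nonneg _) (mem_ball_zero_iff.1 hz).le
      refine h1.trans ?_
      gcongr
      rw [one_le_div (by positivity)]
      have h2 : (k.natAbs : ℝ) + 1 ≤ 2 * (j.natAbs + 1) := by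
        exact_mod_cast (by omega : k.natAbs + 1 ≤ 2 * (j.natAbs + 1))
      have h3 : 0 ≤ weightConst α * ((j.natAbs : ℝ) + 1) := by positivity
      linarith
  refine decaysAlong_of_orthogonal (norm_one_sub_harmonicProj_le α)
    (w := fun k => (‖monomialLp hα k‖ : ℂ)⁻¹ • y k) (fun k l hkl => ?_) (fun k => ?_)
    (by positivity) fun k => norm_inv_smul_le hα k (hnorm k)
  · rw [inner_smul_left, inner_smul_right, inner_eq_zero_of_circle_mul (hyae k) (hyae l)
      (fun h => hkl (add_left_cancel h)) (hrot k) (hrot l), mul_zero, mul_zero]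
  · have h1 : (1 - harmonicProj α) (y k) = (1 - harmonicProj α) (X (monomialLp hα k)) := by
      have h2 : ∀ v ∈ harmonicSubspace α, (1 - harmonicProj α) v = 0 := by
        intro v hv
        rw [sub_apply, one_apply_eq_self, harmonicProj_eq_self hv, sub_self]
      simp only [hy]
      rw [map_sub]
      split_ifs
      · rw [h2 _ (monomialLp_mem hα _), sub_zero]
      · rw [map_zero, sub_zero]
    rw [ContinuousLinearMap.comp_apply, unitMonomial, map_smul, map_smul, map_smul, h1]

/-- A radial symbol preserves frequencies, and the vanishing of `log |z|` on the unit circle already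
supplies the factor `1 - |z|²`, so no correction is needed. The indices with `|k| < 4` are absorbed
by `4 ‖L‖`. -/
theorem exists_decaysAlong_log (hα : -1 < α) {L : L2 α →L[ℂ] L2 α}
    (hL : ∀ f, L f =ᵐ[dA α] fun z => (Real.log ‖z‖ : ℂ) * harmonicProj α f z) :
    ∃ C, 0 ≤ C ∧ DecaysAlong (unitMonomial hα) ((1 - harmonicProj α) ∘L L) C := by
  have hw0 : 0 ≤ weightConst α := Real.sqrt_nonneg _
  have hae : ∀ k, L (monomialLp hα k) =ᵐ[dA α]
      fun z => (Real.log ‖z‖ : ℂ) * harmonicMonomial k z := by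
    intro k
    have h := hL (monomialLp hα k)
    rw [harmonicProj_eq_self (monomialLp_mem hα k)] at h
    filter_upwards [h, coeFn_monomialLp hα k] with z h1 h2
    rw [h1, h2]
  have hrot : ∀ k, ∀ (ω : Circle) (z : ℂ), (Real.log ‖(ω : ℂ) * z‖ : ℂ) * harmonicMonomial k (ω * z) =
      (ω : ℂ) ^ k * ((Real.log ‖z‖ : ℂ) * harmonicMonomial k z) := by
    intro k ω z
    rw [harmonicMonomial_circle_mul, norm_mul, Circle.norm_coe, one_mul]
    ring
  have hnorm : ∀ k, ‖L (monomialLp hα k)‖ ≤ (weightConst α + 4 * ‖L‖) / (k.natAbs + 1) *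
      ‖monomialLp hα k‖ := by
    intro k
    by_cases hk : 4 ≤ k.natAbs
    · refine (norm_le_of_radial_bound hα (hae k) (a := 1) (m := 2) hk zero_le_one
        fun z hz => norm_log_mul_harmonicMonomial_le k hk hz).trans ?_
      gcongr
      rw [one_mul]
      exact le_add_of_nonneg_right (by positivity)
    · refine (L.le_opNorm _).trans ?_
      gcongr
      rw [le_div_iff₀ (by positivity)]
      have h2 : (k.natAbs : ℝ) + 1 ≤ 4 := by
        exact_mod_cast (by omega : k.natAbs + 1 ≤ 4)
      nlinarith [norm_nonneg L]
  refine ⟨weightConst α + 4 * ‖L‖, by positivity, ?_⟩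
  refine decaysAlong_of_orthogonal (norm_one_sub_harmonicProj_le α)
    (w := fun k => (‖monomialLp hα k‖ : ℂ)⁻¹ • L (monomialLp hα k)) (fun k l hkl => ?_) (fun k => ?_)
    (by positivity) fun k => norm_inv_smul_le hα k (hnorm k)
  · rw [inner_smul_left, inner_smul_right, inner_eq_zero_of_circle_mul (hae k) (hae l)
      hkl (hrot k) (hrot l), mul_zero, mul_zero]
  · rw [ContinuousLinearMap.comp_apply, unitMonomial, map_smul]

theorem exists_decaysAlong_harmonic (hα : -1 < α) {h : ℂ → ℂ} {R : ℝ} (hR : 1 < R)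
    (hh : HarmonicOnNhd h (ball 0 R)) {M : L2 α →L[ℂ] L2 α}
    (hM : ∀ f, M f =ᵐ[dA α] fun z => h z * f z) :
    ∃ C, 0 ≤ C ∧ DecaysAlong (unitMonomial hα) ((1 - harmonicProj α) ∘L M) C := by
  obtain ⟨b, hb⟩ := exists_hasSum_harmonicMonomial hh
  choose X hX using fun j => exists_clm_ae_eq_mul_of_continuousOn α
    (continuous_harmonicMonomial j).continuousOn
  have h1 := hasSum_mul_harmonicMonomial hR hb hM hX
  have h2 : HasSum (fun j => b j • ((1 - harmonicProj α) ∘L X j)) ((1 - harmonicProj α) ∘L M) := by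
    simpa using h1.mapL (ContinuousLinearMap.compL ℂ (L2 α) (L2 α) (L2 α) (1 - harmonicProj α))
  have h3 : Summable fun j => ‖b j‖ * ((weightConst α + 2) * (j.natAbs + 1)) := by
    refine ((summable_norm_mul_natAbs hR hb).mul_left (weightConst α + 2)).congr fun j => ?_
    ring
  have hw0 : 0 ≤ weightConst α := Real.sqrt_nonneg _
  exact ⟨_, tsum_nonneg fun j => by positivity,
    DecaysAlong.hasSum (fun j => (decaysAlong_mul_harmonicMonomial hα j (hX j)).smul (b j)) h2 h3⟩

/-- For a symbol `c log |z| + h` with `h` harmonic near the closed disk, `M_u ℙ_α` is bounded, and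
its commutator with its adjoint is in all the classes `𝒞_p` with `p > 1`. -/
theorem exists_clm_isSchatten (hα : -1 < α) {h : ℂ → ℂ} {R : ℝ} (hR : 1 < R)
    (hh : HarmonicOnNhd h (ball 0 R)) (c : ℝ) : ∃ B : L2 α →L[ℂ] L2 α,
      (∀ f, B f =ᵐ[dA α] fun z => (c * Real.log ‖z‖ + h z) * harmonicProj α f z) ∧
      ∀ p : ℝ, 1 < p → IsSchatten p ((1 - harmonicProj α) ∘L B -
        ContinuousLinearMap.adjoint ((1 - harmonicProj α) ∘L B)) := by
  obtain ⟨L, hL⟩ := exists_clm_ae_eq_mul (harmonicProj α) (fun z => (Real.log ‖z‖ : ℂ))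
    fun f => memLp_log_mul hα (harmonicProj_mem α f)
  obtain ⟨M, hM⟩ := exists_clm_ae_eq_mul_of_continuousOn α
    (hh.continuousOn.mono (closedBall_subset_ball hR))
  obtain ⟨C₁, hC₁, h1⟩ := exists_decaysAlong_log hα hL
  obtain ⟨C₂, hC₂, h2⟩ := exists_decaysAlong_harmonic hα hR hh hM
  obtain ⟨e, he⟩ := exists_hilbertBasis hα
  have hLP : L ∘L harmonicProj α = L := by
    ext1 f
    refine Lp.ext ?_
    have h3 := hL (harmonicProj α f)
    rw [harmonicProj_eq_self (harmonicProj_mem α f)] at h3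
    exact h3.trans (hL f).symm
  have hPP : harmonicProj α ∘L harmonicProj α = harmonicProj α := by
    ext1 f
    exact harmonicProj_eq_self (harmonicProj_mem α f)
  refine ⟨(c : ℂ) • L + M ∘L harmonicProj α, fun f => ?_, fun p hp => ?_⟩
  · filter_upwards [hL f, hM (harmonicProj α f), Lp.coeFn_add ((c : ℂ) • L f) (M (harmonicProj α f)),
      Lp.coeFn_smul (c : ℂ) (L f)] with z h3 h4 h5 h6
    rw [add_apply, smul_apply, ContinuousLinearMap.comp_apply, h5, Pi.add_apply, h6, Pi.smul_apply,
      h3, h4, smul_eq_mul]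
    ring
  · refine isSchatten_sub_adjoint (C := ‖(c : ℂ)‖ * C₁ + C₂) (fun N => ?_) hp
    refine DecaysAlong.exists_submodule e (by positivity) ?_ ?_ N
    · have h3 := (h1.smul (c : ℂ)).add h2
      intro N s a ha
      have h4 := h3 N s a ha
      have h5 : ∀ k, (e k : L2 α) = unitMonomial hα k := he
      simp_rw [h5]
      convert h4 using 2
      -- On combinations of monomials the inner projection acts as the identity, so the estimate for
      -- multiplication by `h` applies as it stands.
      have h6 : harmonicProj α (∑ k ∈ s, a k • unitMonomial hα k) =
          ∑ k ∈ s, a k • unitMonomial hα k := by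
        refine harmonicProj_eq_self (Submodule.sum_mem _ fun k _ => Submodule.smul_mem _ _ ?_)
        rw [← h5]
        exact (e k).2
      simp only [ContinuousLinearMap.comp_apply, add_apply, smul_apply, h6, map_add, map_smul]
    · change _ ∘L harmonicProj α = _
      rw [ContinuousLinearMap.comp_assoc, ContinuousLinearMap.add_comp, ContinuousLinearMap.smul_comp,
        hLP, ContinuousLinearMap.comp_assoc, hPP]

end Symbols

/-! ### The form of the symbol and criteria for constancy. -/

section SymbolStructure

variable {R : ℝ} {u : ℂ → EReal}

/-- A subharmonic function on a disk that is harmonic off the centre is the sum of a multiple of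
`log |z|` and a harmonic function, off the centre. -/
theorem SubharmonicOn.exists_log_add_harmonic (hR : 1 < R) (hsub : SubharmonicOn u (ball 0 R))
    (hharm : ERealHarmonicOn u (ball 0 R \ {0})) :
    ∃ (c : ℝ) (h : ℂ → ℝ), HarmonicOnNhd h (ball 0 R) ∧
      ∀ z ∈ ball (0 : ℂ) R \ {0}, u z = ((c * Real.log ‖z‖ + h z : ℝ) : EReal) := by
  obtain ⟨v, hv, huv⟩ := hharm
  have h0 : (0 : ℂ) ∈ ball (0 : ℂ) R := mem_ball_self (by linarith)
  obtain ⟨M, hM, -⟩ := EReal.lt_iff_exists_real_btwn.1 (hsub.lt_top 0 h0)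
  have h1 : ∀ᶠ z in 𝓝 (0 : ℂ), u z < M := by
    have := hsub.upperSemicontinuousOn 0 h0 M hM
    rwa [isOpen_ball.nhdsWithin_eq h0] at this
  have h2 : ∀ᶠ z in 𝓝[≠] (0 : ℂ), v z ≤ M := by
    filter_upwards [h1.filter_mono nhdsWithin_le_nhds, self_mem_nhdsWithin,
      nhdsWithin_le_nhds (ball_mem_nhds (0 : ℂ) (by linarith : 0 < R))] with z hz hz0 hzR
    rw [huv z ⟨hzR, hz0⟩] at hz
    exact (EReal.coe_lt_coe_iff.1 hz).le
  obtain ⟨c, h, hh, hvh⟩ := exists_harmonicOnNhd_add_log hR hv h2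
  exact ⟨c, h, hh, fun z hz => by rw [huv z hz, hvh z hz]⟩

/-- The value at the centre is determined by the values off the centre. -/
theorem SubharmonicOn.eq_of_eq_off_center (hR : 1 < R) (hsub : SubharmonicOn u (ball 0 R)) {a : ℝ}
    (ha : ∀ z ∈ ball (0 : ℂ) R \ {0}, u z = (a : EReal)) : u 0 = (a : EReal) := by
  have h0 : (0 : ℂ) ∈ ball (0 : ℂ) R := mem_ball_self (by linarith)
  refine le_antisymm ?_ ?_
  -- The upper bound compares with the constant `a` on the unit disk; the lower bound is upper
  -- semicontinuity, as `u 0 < a` would force `u < a` nearby.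
  · refine hsub.le_harmonic 0 1 one_pos (closedBall_subset_ball hR) (fun _ => a)
      harmonicContOnCl_const (fun z hz => ?_) 0 (mem_ball_self one_pos)
    have hz1 : ‖z‖ = 1 := by simpa using hz
    refine (ha z ⟨by simpa [hz1] using hR, ?_⟩).le
    rintro rfl
    simp at hz1
  · by_contra! hlt
    have h1 : ∀ᶠ z in 𝓝 (0 : ℂ), u z < a := by
      have := hsub.upperSemicontinuousOn 0 h0 a hlt
      rwa [isOpen_ball.nhdsWithin_eq h0] at this
    have h2 : ∀ᶠ z in 𝓝[≠] (0 : ℂ), u z < a ∧ z ∈ ball (0 : ℂ) R ∧ z ≠ 0 := by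
      filter_upwards [h1.filter_mono nhdsWithin_le_nhds, self_mem_nhdsWithin,
        nhdsWithin_le_nhds (ball_mem_nhds (0 : ℂ) (by linarith : 0 < R))] with z hz hz0 hzR
      exact ⟨hz, hzR, hz0⟩
    obtain ⟨z, h2, h3, h4⟩ := h2.exists
    rw [ha z ⟨h3, h4⟩] at h2
    exact lt_irrefl _ h2

/-- A harmonic function whose square is harmonic on the unit disk is constant. -/
theorem eq_const_of_harmonic_sq {h : ℂ → ℝ} (hR : 1 ≤ R) (hh : HarmonicOnNhd h (ball 0 R))
    (hsq : HarmonicOnNhd (fun z => h z ^ 2) (ball 0 1)) : ∀ z ∈ ball (0 : ℂ) R, h z = h 0 := by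
  have hh1 : HarmonicOnNhd h (ball 0 1) := hh.mono (ball_subset_ball hR)
  set g : ℂ → ℝ := fun z => (h z - h 0) ^ 2 with hg
  have hgh : HarmonicOnNhd g (ball 0 1) := by
    have h1 : g = (fun z => h z ^ 2) - (2 * h 0) • h + fun _ => h 0 ^ 2 := by
      ext z
      simp [hg]
      ring
    rw [h1]
    exact (hsq.sub (hh1.const_smul)).add (harmonicOnNhd_const _)
  have h1 : ∀ z ∈ ball (0 : ℂ) 1, h z = h 0 := by
    intro z hz
    by_contra hne
    have hz1 : ‖z‖ < 1 := by simpa using hz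
    have hsub : closedBall (0 : ℂ) |‖z‖| ⊆ ball 0 1 := by
      rw [abs_norm]
      exact closedBall_subset_ball hz1
    have h2 : Real.circleAverage g 0 ‖z‖ = g 0 :=
      InnerProductSpace.HarmonicOnNhd.circleAverage_eq (hgh.mono hsub)
    have h3 : g 0 = 0 := by simp [hg]
    obtain ⟨θ, hθ, hθz⟩ : z ∈ circleMap 0 ‖z‖ '' Set.Ioc 0 (2 * Real.pi) := by
      rw [image_circleMap_Ioc]
      simp
    -- On the circle through `z`, `g` is nonnegative, continuous and positive at `z`, which
    -- contradicts the mean value property with `g 0 = 0`.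
    have h4 : 0 < ∫ θ in (0 : ℝ)..2 * Real.pi, g (circleMap 0 ‖z‖ θ) := by
      refine intervalIntegral.integral_pos (by positivity) ?_ (fun θ _ => sq_nonneg _)
        ⟨θ, ⟨hθ.1.le, hθ.2⟩, ?_⟩
      · refine hgh.continuousOn.comp (continuous_circleMap 0 ‖z‖).continuousOn fun θ _ => hsub ?_
        exact sphere_subset_closedBall (circleMap_mem_sphere' 0 ‖z‖ θ)
      · rw [hθz]
        exact sq_pos_of_ne_zero (sub_ne_zero.2 hne)
    rw [Real.circleAverage_def, h3, smul_eq_mul] at h2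
    have h5 : 0 < (2 * Real.pi)⁻¹ := by positivity
    exact (mul_pos h5 h4).ne' h2
  have h2 : Set.EqOn h (fun _ => h 0) (ball 0 R) := by
    -- Real analyticity propagates constancy from the unit disk to the larger disk.
    refine AnalyticOnNhd.eqOn_of_preconnected_of_eventuallyEq (𝕜 := ℝ) (z₀ := 0)
      (fun z hz => HarmonicAt.analyticAt (hh z hz)) (fun z _ => analyticAt_const)
      (convex_ball _ _).isPreconnected (mem_ball_self (by linarith)) ?_
    filter_upwards [ball_mem_nhds (0 : ℂ) one_pos] with z hz using h1 z hz
  exact h2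

end SymbolStructure

/-! ### Unbounded operators composed with a projection. -/

section Composition

variable {E : Type*} [NormedAddCommGroup E] [InnerProductSpace ℂ E] {A : E →ₗ.[ℂ] E} {P : E →L[ℂ] E}

theorem commutes_iff (hP : ∀ f, P f ∈ A.domain) :
    Commutes A P ↔ ∀ f : A.domain, A ⟨P f, hP f⟩ = P (A f) := by
  refine ⟨fun h f => ?_, fun h => ⟨fun f _ => hP f, fun x y hxy => ?_⟩⟩
  · exact (h.2 (x := f) (y := ⟨f, hP f⟩) rfl).symm
  · obtain ⟨y, hy⟩ := y
    obtain rfl : (x : E) = y := hxy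
    exact (h x).symm

theorem commutator_apply (f : (commutator A P).domain) :
    commutator A P f = A ⟨P f, f.2.1⟩ - P (A ⟨f, f.2.2⟩) := rfl

end Composition

/-! ### The commutator as a bounded operator minus its adjoint. -/

section Commutator

variable {α : ℝ}

/-- The density is positive on the disk, so equality almost everywhere also holds for Lebesgue
measure, and continuity upgrades it to equality everywhere. -/
theorem eqOn_ball_of_ae_eq (hα : -1 < α) {f g : ℂ → ℂ} {U : Set ℂ} (hU : IsOpen U)
    (hUb : U ⊆ ball 0 1) (h : f =ᵐ[dA α] g) (hf : ContinuousOn f U) (hg : ContinuousOn g U) :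
    Set.EqOn f g U := by
  refine Measure.eqOn_open_of_ae_eq (μ := (volume : Measure ℂ)) ?_ hU hf hg
  have h1 : volume.restrict (ball (0 : ℂ) 1) ≪ dA α := by
    refine withDensity_absolutelyContinuous' (measurable_density α).aemeasurable ?_
    refine (ae_restrict_iff' measurableSet_ball).2 (ae_of_all _ fun z hz => ?_)
    have hz1 : ‖z‖ < 1 := by simpa using hz
    have h2 : 0 < 1 - ‖z‖ ^ 2 := by nlinarith [norm_nonneg z]
    have h3 : 0 < α + 1 := by linarith
    have := Real.pi_pos
    exact (ENNReal.ofReal_pos.2 (by positivity)).ne'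
  exact ((Measure.restrict_mono_set volume hUb).absolutelyContinuous.trans h1).ae_le h

theorem coeFn_mulOp (φ : ℂ → ℂ) (f : (mulOp α φ).domain) :
    mulOp α φ f =ᵐ[dA α] fun z => φ z * (f : L2 α) z :=
  MemLp.coeFn_toLp f.2

variable {φ : ℂ → ℂ} {B : L2 α →L[ℂ] L2 α}

theorem harmonicProj_mem_domain (hB : ∀ f, B f =ᵐ[dA α] fun z => φ z * harmonicProj α f z)
    (f : L2 α) : harmonicProj α f ∈ (mulOp α φ).domain :=
  (memLp_congr_ae (hB f)).1 (Lp.memLp (B f))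

theorem mulOp_harmonicProj (hB : ∀ f, B f =ᵐ[dA α] fun z => φ z * harmonicProj α f z)
    (f : L2 α) (hf : harmonicProj α f ∈ (mulOp α φ).domain) :
    mulOp α φ ⟨harmonicProj α f, hf⟩ = B f :=
  Lp.ext ((coeFn_mulOp φ _).trans (hB f).symm)

theorem commutes_mulOp_iff (hB : ∀ f, B f =ᵐ[dA α] fun z => φ z * harmonicProj α f z) :
    Commutes (mulOp α φ) (harmonicProj α) ↔
      ∀ f : (mulOp α φ).domain, B f = harmonicProj α (mulOp α φ f) := by
  rw [commutes_iff (harmonicProj_mem_domain hB)]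
  simp_rw [mulOp_harmonicProj hB]

/-- The real symbol moves across the inner product, and the projection is self-adjoint. -/
theorem adjoint_apply_of_mem_domain (hφ : ∀ z, starRingEnd ℂ (φ z) = φ z)
    (hB : ∀ f, B f =ᵐ[dA α] fun z => φ z * harmonicProj α f z) (f : (mulOp α φ).domain) :
    ContinuousLinearMap.adjoint B f = harmonicProj α (mulOp α φ f) := by
  refine ext_inner_left ℂ fun g => ?_
  rw [ContinuousLinearMap.adjoint_inner_right]
  have h1 : inner ℂ g (harmonicProj α (mulOp α φ f)) = inner ℂ (harmonicProj α g) (mulOp α φ f) :=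
    ((harmonicSubspace α).inner_starProjection_left_eq_right g _).symm
  rw [h1, L2.inner_def, L2.inner_def]
  refine integral_congr_ae ?_
  filter_upwards [hB g, coeFn_mulOp φ f] with z h2 h3
  rw [h2, h3, RCLike.inner_apply, RCLike.inner_apply, map_mul, hφ]
  ring

/-- On the domain `B* f = ℙ (φ f)`, and the same identity at `ℙ f` reads `B* ℙ f = ℙ B f`. These two
cross terms cancel in `(1 - ℙ) B - B* (1 - ℙ)`, which leaves `B f - ℙ (φ f)`. -/
theorem commutator_apply_eq (hφ : ∀ z, starRingEnd ℂ (φ z) = φ z)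
    (hB : ∀ f, B f =ᵐ[dA α] fun z => φ z * harmonicProj α f z)
    (f : (commutator (mulOp α φ) (harmonicProj α)).domain) :
    ((1 - harmonicProj α) ∘L B - ContinuousLinearMap.adjoint ((1 - harmonicProj α) ∘L B) :
      L2 α →L[ℂ] L2 α) f =
      commutator (mulOp α φ) (harmonicProj α) f := by
  have h1 : commutator (mulOp α φ) (harmonicProj α) f =
      B f - harmonicProj α (mulOp α φ ⟨f, f.2.2⟩) := by
    rw [commutator_apply, mulOp_harmonicProj hB f f.2.1]
  have h2 : ContinuousLinearMap.adjoint (1 - harmonicProj α) = 1 - harmonicProj α := by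
    rw [map_sub, ← ContinuousLinearMap.star_eq_adjoint, ← ContinuousLinearMap.star_eq_adjoint, star_one]
    congr 1
    exact (isSelfAdjoint_starProjection (harmonicSubspace α)).star_eq
  have h3 := adjoint_apply_of_mem_domain hφ hB ⟨f, f.2.2⟩
  have h4 := adjoint_apply_of_mem_domain hφ hB ⟨harmonicProj α f, f.2.1⟩
  rw [mulOp_harmonicProj hB f f.2.1] at h4
  simp only at h3 h4
  rw [h1, sub_apply, ContinuousLinearMap.adjoint_comp, h2, ContinuousLinearMap.comp_apply,
    ContinuousLinearMap.comp_apply, sub_apply, sub_apply, map_sub, one_apply_eq_self,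
    one_apply_eq_self, h3, h4]
  abel

/-- The domain contains the simple functions: they are bounded and `φ` is in `L²`, while the
condition on `ℙ f` always holds. -/
theorem dense_domain_commutator (hφ : MemLp φ 2 (dA α))
    (hB : ∀ f, B f =ᵐ[dA α] fun z => φ z * harmonicProj α f z) :
    Dense ((commutator (mulOp α φ) (harmonicProj α)).domain : Set (L2 α)) := by
  refine Dense.mono ?_ (Lp.simpleFunc.denseRange (E := ℂ) (μ := dA α) (p := 2) (by norm_num))
  rintro _ ⟨s, rfl⟩
  refine ⟨harmonicProj_mem_domain hB _, ?_⟩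
  obtain ⟨K, hK⟩ := (Lp.simpleFunc.toSimpleFunc s).exists_forall_norm_le
  refine hφ.of_le_mul (c := K) (hφ.1.mul (Lp.aestronglyMeasurable _)) ?_
  filter_upwards [Lp.simpleFunc.toSimpleFunc_eq_toFun s] with z hz
  rw [norm_mul, mul_comm]
  refine mul_le_mul_of_nonneg_right ?_ (norm_nonneg _)
  rw [← hz]
  exact hK z

end Commutator

/-! ### Commutation forces the symbol to be constant. -/

section Constancy

variable {α : ℝ} {φ : ℂ → ℂ} {B : L2 α →L[ℂ] L2 α}

/-- If a real symbol `c log |z| + h` commutes with the harmonic projection, then `c = 0` and `h` is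
constant. -/
theorem eq_const_of_commutes (hα : -1 < α) {R c : ℝ} (hR : 1 < R) {h : ℂ → ℝ}
    (hh : HarmonicOnNhd h (ball 0 R)) (hφ : φ =ᵐ[dA α] fun z => c * Real.log ‖z‖ + h z)
    (hB : ∀ f, B f =ᵐ[dA α] fun z => φ z * harmonicProj α f z)
    (hcomm : ∀ f : (mulOp α φ).domain, B f = harmonicProj α (mulOp α φ f)) :
    c = 0 ∧ ∀ z ∈ ball (0 : ℂ) R, h z = h 0 := by
  have hh1 : HarmonicOnNhd h (ball 0 1) := hh.mono (ball_subset_ball hR.le)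
  have hhc : ContinuousOn (fun z => (h z : ℂ)) (ball 0 1) :=
    Complex.continuous_ofReal.comp_continuousOn hh1.continuousOn
  have hone : monomialLp hα 0 =ᵐ[dA α] fun _ => 1 := by
    filter_upwards [coeFn_monomialLp hα 0] with z hz
    rw [hz, harmonicMonomial]
    simp
  set ψ : L2 α := B (monomialLp hα 0) with hψ
  have hψφ : ψ =ᵐ[dA α] φ := by
    have h1 := hB (monomialLp hα 0)
    rw [harmonicProj_eq_self (monomialLp_mem hα 0)] at h1
    filter_upwards [h1, hone] with z h1 h2
    rw [h1, h2, mul_one]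
  have hmem0 : monomialLp hα 0 ∈ (mulOp α φ).domain := by
    have h1 := harmonicProj_mem_domain hB (monomialLp hα 0)
    rwa [harmonicProj_eq_self (monomialLp_mem hα 0)] at h1
  -- Commutation at the constant `1` says that the symbol equals its own harmonic projection.
  have hψmem : ψ ∈ harmonicSubspace α := by
    have h1 := hcomm ⟨_, hmem0⟩
    rw [hψ, h1]
    exact harmonicProj_mem α _
  obtain ⟨k, hk, hψk⟩ := id hψmem
  have hlogc : ContinuousOn (fun z : ℂ => (c * Real.log ‖z‖ + h z : ℂ)) (ball 0 1 \ {0}) := by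
    refine ContinuousOn.add ?_ (hhc.mono Set.sdiff_subset)
    refine continuousOn_const.mul (Complex.continuous_ofReal.comp_continuousOn ?_)
    exact ContinuousOn.log continuous_norm.continuousOn fun z hz => norm_ne_zero_iff.2 hz.2
  have he1 : Set.EqOn (fun z : ℂ => (c * Real.log ‖z‖ + h z : ℂ)) k (ball 0 1 \ {0}) :=
    eqOn_ball_of_ae_eq hα (isOpen_ball.sdiff isClosed_singleton) Set.sdiff_subset
      ((hφ.symm.trans hψφ.symm).trans hψk) hlogc (hk.continuousOn.mono Set.sdiff_subset)
  have hc : c = 0 := by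
    by_contra hc
    have h0 : (0 : ℂ) ∈ ball (0 : ℂ) 1 := mem_ball_self one_pos
    have t1 : Tendsto (fun z : ℂ => (k z).re - h z) (𝓝[≠] 0) (𝓝 ((k 0).re - h 0)) := by
      have e1 : ContinuousAt (fun z : ℂ => (k z).re - h z) 0 :=
        (Complex.continuous_re.continuousAt.comp
          (hk.continuousOn.continuousAt (isOpen_ball.mem_nhds h0))).sub
          (hh1.continuousOn.continuousAt (isOpen_ball.mem_nhds h0))
      exact e1.tendsto.mono_left nhdsWithin_le_nhds
    -- If `c ≠ 0`, the continuity at `0` of the harmonic representative would give `log |z|` a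
    -- finite limit.
    have t2 : Tendsto (fun z : ℂ => Real.log ‖z‖) (𝓝[≠] 0) (𝓝 (((k 0).re - h 0) / c)) := by
      refine (t1.div_const c).congr' ?_
      filter_upwards [self_mem_nhdsWithin, nhdsWithin_le_nhds (ball_mem_nhds (0 : ℂ) one_pos)]
        with z hz0 hz1
      rw [← he1 ⟨hz1, hz0⟩]
      simp only [Complex.add_re, Complex.re_ofReal_mul, Complex.ofReal_re]
      field_simp
      ring
    have t3 : Tendsto (fun z : ℂ => Real.log ‖z‖) (𝓝[≠] 0) atBot :=
      Real.tendsto_log_nhdsGT_zero.comp tendsto_norm_nhdsNE_zero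
    exact not_tendsto_nhds_of_tendsto_atBot t3 _ t2
  refine ⟨hc, eq_const_of_harmonic_sq hR.le hh ?_⟩
  have hφh : φ =ᵐ[dA α] fun z => (h z : ℂ) := by
    filter_upwards [hφ] with z hz
    rw [hz, hc]
    simp
  have hPψ := harmonicProj_eq_self hψmem
  have hψdom : ψ ∈ (mulOp α φ).domain := by
    have h1 := harmonicProj_mem_domain hB ψ
    rwa [hPψ] at h1
  -- Commutation at the symbol itself: `B ψ` is the square of the symbol and lies in the range of
  -- the projection.
  have hBψ : B ψ ∈ harmonicSubspace α := by
    rw [hcomm ⟨ψ, hψdom⟩]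
    exact harmonicProj_mem α _
  obtain ⟨q, hq, hBq⟩ := hBψ
  have h1 := hB ψ
  rw [hPψ] at h1
  have he2 : Set.EqOn (fun z => (h z : ℂ) * h z) q (ball 0 1) := by
    refine eqOn_ball_of_ae_eq hα isOpen_ball subset_rfl ?_ (hhc.mul hhc) hq.continuousOn
    filter_upwards [h1, hBq, hφh, hψφ] with z e1 e2 e3 e4
    rw [← e2, e1, e4, e3]
  have hqre := hq.comp_CLM Complex.reCLM
  intro z hz
  refine (harmonicAt_congr_nhds ?_).2 (hqre z hz)
  filter_upwards [isOpen_ball.mem_nhds hz] with w hw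
  rw [Function.comp_apply, ← he2 hw]
  simp [sq]

end Constancy

end HarmonicCommutator

theorem mainTheorem2 (α : ℝ) (hα : -1 < α) (R : ℝ) (hR : 1 < R) (u : ℂ → EReal)
    (hsub : HarmonicCommutator.SubharmonicOn u (Metric.ball 0 R))
    (hharm : HarmonicCommutator.ERealHarmonicOn u (Metric.ball 0 R \ {0})) :
    (HarmonicCommutator.Commutes (HarmonicCommutator.Mu α u) (HarmonicCommutator.harmonicProj α) ↔
      ∃ c : ℝ, ∀ z ∈ Metric.ball (0 : ℂ) R, u z = (c : EReal)) ∧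
    ∀ p : ℝ, 1 < p → HarmonicCommutator.IsDenselyDefinedSchatten p (HarmonicCommutator.Cu α u) := by
  open HarmonicCommutator MeasureTheory Metric InnerProductSpace in
  obtain ⟨c, h, hh, hu⟩ := hsub.exists_log_add_harmonic hR hharm
  have hhC : HarmonicOnNhd (fun z => (h z : ℂ)) (ball 0 R) := hh.comp_CLM Complex.ofRealCLM
  obtain ⟨B, hB, hS⟩ := exists_clm_isSchatten hα hR hhC c
  -- The origin, where `u` may be `-∞` and `toReal` takes a default value, is a null set.
  have hφ : (fun z => ((u z).toReal : ℂ)) =ᵐ[dA α] fun z => c * Real.log ‖z‖ + h z := by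
    filter_upwards [ae_dA_mem_ball α, ae_dA_ne_zero α] with z hz hz0
    rw [hu z ⟨ball_subset_ball hR.le hz, hz0⟩, EReal.toReal_coe]
    push_cast
    rfl
  have hB' : ∀ f, B f =ᵐ[dA α] fun z => ((u z).toReal : ℂ) * harmonicProj α f z := by
    intro f
    filter_upwards [hB f, hφ] with z h1 h2
    rw [h1, h2]
  have hφL : MemLp (fun z => ((u z).toReal : ℂ)) 2 (dA α) := by
    have h1 := hB' (monomialLp hα 0)
    rw [harmonicProj_eq_self (monomialLp_mem hα 0)] at h1
    refine (memLp_congr_ae ?_).1 (Lp.memLp (B (monomialLp hα 0)))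
    filter_upwards [h1, coeFn_monomialLp hα 0] with z h1 h2
    rw [h1, h2, harmonicMonomial]
    simp
  refine ⟨(commutes_mulOp_iff hB').trans ⟨fun hcomm => ?_, ?_⟩, fun p hp =>
    ⟨dense_domain_commutator hφL hB', _, commutator_apply_eq (fun z => Complex.conj_ofReal _) hB',
      hS p hp⟩⟩
  · obtain ⟨hc, hconst⟩ := eq_const_of_commutes hα hR hh hφ hB' hcomm
    have hoff : ∀ z ∈ ball (0 : ℂ) R \ {0}, u z = (h 0 : EReal) := by
      intro z hz
      rw [hu z hz, hc, zero_mul, zero_add, hconst z hz.1]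
    refine ⟨h 0, fun z hz => ?_⟩
    by_cases hz0 : z = 0
    · rw [hz0]
      exact hsub.eq_of_eq_off_center hR hoff
    · exact hoff z ⟨hz, hz0⟩
  · rintro ⟨a, ha⟩ f
    have hφa : ∀ᵐ z ∂(dA α), ((u z).toReal : ℂ) = a := by
      filter_upwards [ae_dA_mem_ball α] with z hz
      rw [ha z (ball_subset_ball hR.le hz), EReal.toReal_coe]
    have h1 : mulOp α (fun z => ((u z).toReal : ℂ)) f = (a : ℂ) • (f : L2 α) := by
      refine Lp.ext ?_
      filter_upwards [coeFn_mulOp _ f, hφa, Lp.coeFn_smul (a : ℂ) (f : L2 α)] with z e1 e2 e3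
      rw [e1, e2, e3]
      rfl
    rw [h1, map_smul]
    refine Lp.ext ?_
    filter_upwards [hB' f, hφa, Lp.coeFn_smul (a : ℂ) (harmonicProj α f)] with z e1 e2 e3
    rw [e1, e2, e3]
    rfl
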